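/- Let $n\in\mathbb N$, $\tfrac12\le s<1$ and $0<\lambda\le\Lambda$. Let $\mathcal K_s$ be the set of measurable kernels $K$ on $\mathbb R^n\setminus\{0\}$ with $\lambda|z|^{-n-2s}\le K(z)\le\Lambda|z|^{-n-2s}$ for all $z\ne0$, and let $\mathcal K_{\rm sym}$ be the set of those $K\in\mathcal K_s$ with $K(z)=K(-z)$ for all $z\neq 0$. For $K\in\mathcal K_s$ put $$L_Ku(x)=\int_{\mathbb R^n}\bigl[u(x+z)-u(x)-\mathbf 1_{\{|z|<1\}}\nabla u(x)\cdot z\bigr]K(z)\,dz .$$ Let $L^1(\omega_s)$ be the space of functions integrable with respect to $\omega_s(z)\,dz$, $\omega_s(z)=(1+|z|)^{-n-2s}$, and write $u\in C^{1,1}(x)$ if there are $p\in\mathbb R^n$ and $C,r>0$ with $|u(x+z)-u(x)-p\cdot z|\le C|z|^2$ for $|z|<r$. An operator $\mathcal I$, for which $\mathcal Iu(x)$ is defined whenever $u\in C^{1,1}(x)\cap L^1(\omega_s)$, is called translation invariant if $\mathcal I(u(\cdot+h))(x)=\mathcal Iu(x+h)$, positively $1$-homogeneous if $\mathcal I(tu)=t\,\mathcal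 Iu$ for $t>0$, and elliptic with respect to a class $\mathcal K$ of kernels if $$\inf_{K\in\mathcal K}\bigl(L_Ku(x)-L_Kv(x)\bigr)\le\mathcal Iu(x)-\mathcal Iv(x)\le\sup_{K\in\mathcal K}\bigl(L_Ku(x)-L_Kv(x)\bigr)$$ for all $x\in\mathbb R^n$ and $u,v\in C^{1,1}(x)\cap L^1(\omega_s)$. A measurable function $u\in L^1(\omega_s)$ is a viscosity subsolution (supersolution) of $-\mathcal Iu+H(u,\nabla u)=0$ in $\mathbb R^n$ if it is upper (lower) semicontinuous and, for all $x_0\in\mathbb R^n$, $r>0$ and $\varphi\in C^2(B_r(x_0))$ with $\varphi(x_0)=u(x_0)$ and $u\le\varphi$ (resp. $u\ge\varphi$) in $B_r(x_0)$, the function $v$ equal to $\varphi$ in $B_r(x_0)$ and to $u$ elsewhere satisfies $-\mathcal Iv(x_0)+H(u(x_0),\nabla\varphi(x_0))\le0$ (resp. $\ge0$) whenever $v\in L^1(\omega_s)$; it is a viscosity solution if it is both a subsolution and a supersolution. (i) Let $\mathcal I$ be translation invariant, positively $1$-homogeneous and elliptic with respect to $\mathcal K_s$, and let $q,m\ge0$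 with $q+m>1$ (with the convention $0^0=1$). If $u$ is a non-negative viscosity solution of $$-\mathcal Iu+u^q|\nabla u|^m=0\quad\text{in }\mathbb R^n$$ and $|u(x)|\le M(1+|x|)^\gamma$ for all $x\in\mathbb R^n$, for some $M$ and some $\gamma<1$, then $u$ is constant. (ii) Let $\mathcal I_{\rm sym}$ be translation invariant, positively $1$-homogeneous and elliptic with respect to $\mathcal K_{\rm sym}$, and let $m>1$. If $u$ is a non-negative viscosity solution of $$-\mathcal I_{\rm sym}u+|\nabla u|^m=0\quad\text{in }\mathbb R^n$$ and, for some $M$ and some $\gamma<2s$, $$|u(x)|\le M(1+|x|)^\gamma\ \text{ for all }x\in\mathbb R^n\qquad\text{and}\qquad\limsup_{|x|\to\infty}\frac{|u(x)|}{|x|^\gamma}>0,$$ then $u$ is constant. -/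

import Mathlib

open Filter Topology MeasureTheory

/-- The kernel class `𝒦_s(lam, Lam)`: measurable kernels comparable to `|z|^{-n-2s}`.  The value of
a kernel at the origin is irrelevant. -/
def kernelClass (n : ℕ) (s lam Lam : ℝ) : Set (EuclideanSpace ℝ (Fin n) → ℝ) :=
  {K | Measurable K ∧ ∀ z, z ≠ 0 →
    lam / ‖z‖ ^ ((n : ℝ) + 2 * s) ≤ K z ∧ K z ≤ Lam / ‖z‖ ^ ((n : ℝ) + 2 * s)}

/-- The subclass `𝒦_sym(lam, Lam)` of the symmetric kernels. -/
def symKernelClass (n : ℕ) (s lam Lam : ℝ) : Set (EuclideanSpace ℝ (Fin n) → ℝ) :=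
  {K | K ∈ kernelClass n s lam Lam ∧ ∀ z, z ≠ 0 → K z = K (-z)}

/-- The linear operator
`L_K u(x) = ∫ [u(x+z) - u(x) - 1_{2s ∈ [1,2)} 1_B(z) ∇u(x)·z] K(z) dz`, `B` the unit ball. -/
noncomputable def linOp {n : ℕ} (s : ℝ) (K : EuclideanSpace ℝ (Fin n) → ℝ)
    (u : EuclideanSpace ℝ (Fin n) → ℝ) (x : EuclideanSpace ℝ (Fin n)) : ℝ :=
  ∫ z, (u (x + z) - u x
    - (if (1 ≤ 2 * s ∧ 2 * s < 2) ∧ ‖z‖ < 1 then inner ℝ (gradient u x) z else 0)) * K z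

/-- `u ∈ L¹(ω_s)` for the weight `ω_s(z) = (1+|z|)^{-n-2s}`. -/
def MemWeightedL1 {n : ℕ} (s : ℝ) (u : EuclideanSpace ℝ (Fin n) → ℝ) : Prop :=
  Integrable (fun z => u z * (1 + ‖z‖) ^ (-((n : ℝ) + 2 * s))) volume

/-- `u ∈ C^{1,1}(x)`: at the point `x` the function `u` has a first order expansion with a
quadratic error (in particular `u` is differentiable at `x`). -/
def IsC11At {n : ℕ} (u : EuclideanSpace ℝ (Fin n) → ℝ) (x : EuclideanSpace ℝ (Fin n)) : Prop :=
  ∃ p : EuclideanSpace ℝ (Fin n), ∃ C r : ℝ, 0 < r ∧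
    ∀ z, ‖z‖ < r → |u (x + z) - u x - inner ℝ p z| ≤ C * ‖z‖ ^ 2

/-- `u ∈ C^{1,1}(x) ∩ L¹(ω_s)`: the functions at which the nonlocal operators are evaluated at
the point `x`. -/
def Admissible {n : ℕ} (s : ℝ) (u : EuclideanSpace ℝ (Fin n) → ℝ)
    (x : EuclideanSpace ℝ (Fin n)) : Prop :=
  IsC11At u x ∧ MemWeightedL1 s u

/-- `I` is a translation invariant, positively `1`-homogeneous nonlocal operator which is elliptic
with respect to the class `𝒦` of kernels.  Only the values `I u x` with `u ∈ C^{1,1}(x) ∩ L¹(ω_s)`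
matter.  For such functions and `𝒦` one of the two classes above with `0 < lam ≤ Lam`, `0 < s < 1`,
the infimum and the supremum are over a nonempty bounded set of real numbers. -/
structure IsEllipticOperator {n : ℕ} (s : ℝ) (𝒦 : Set (EuclideanSpace ℝ (Fin n) → ℝ))
    (I : (EuclideanSpace ℝ (Fin n) → ℝ) → EuclideanSpace ℝ (Fin n) → ℝ) : Prop where
  translation_invariant : ∀ (u : EuclideanSpace ℝ (Fin n) → ℝ) (x h : EuclideanSpace ℝ (Fin n)),
    Admissible s u (x + h) → I (fun y => u (y + h)) x = I u (x + h)
  pos_homogeneous : ∀ (u : EuclideanSpace ℝ (Fin n) → ℝ) (x : EuclideanSpace ℝ (Fin n)) (t : ℝ),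
    0 < t → Admissible s u x → I (fun y => t * u y) x = t * I u x
  elliptic : ∀ (u v : EuclideanSpace ℝ (Fin n) → ℝ) (x : EuclideanSpace ℝ (Fin n)),
    Admissible s u x → Admissible s v x →
      (⨅ K : 𝒦, (linOp s K.1 u x - linOp s K.1 v x)) ≤ I u x - I v x ∧
        I u x - I v x ≤ ⨆ K : 𝒦, (linOp s K.1 u x - linOp s K.1 v x)

/-- The function equal to `φ` in the ball `B_r(x₀)` and to `u` elsewhere. -/
noncomputable def testPatch {n : ℕ} (u φ : EuclideanSpace ℝ (Fin n) → ℝ)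
    (x₀ : EuclideanSpace ℝ (Fin n)) (r : ℝ) (y : EuclideanSpace ℝ (Fin n)) : ℝ :=
  if dist y x₀ < r then φ y else u y

/-- Viscosity subsolutions of `-I u + H(u, ∇u) = 0` in `ℝⁿ`.  Test functions `φ` whose patched
function is not in `L¹(ω_s)` (because `φ` blows up at the boundary of the ball) are not used, as
`I` cannot be evaluated there. -/
structure IsViscositySubsolution {n : ℕ} (s : ℝ)
    (I : (EuclideanSpace ℝ (Fin n) → ℝ) → EuclideanSpace ℝ (Fin n) → ℝ)
    (H : ℝ → EuclideanSpace ℝ (Fin n) → ℝ) (u : EuclideanSpace ℝ (Fin n) → ℝ) : Prop where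
  measurable : Measurable u
  memWeightedL1 : MemWeightedL1 s u
  upperSemicontinuous : UpperSemicontinuous u
  test : ∀ (x₀ : EuclideanSpace ℝ (Fin n)) (r : ℝ) (φ : EuclideanSpace ℝ (Fin n) → ℝ), 0 < r →
    ContDiffOn ℝ 2 φ (Metric.ball x₀ r) → u x₀ = φ x₀ → (∀ y ∈ Metric.ball x₀ r, u y ≤ φ y) →
    MemWeightedL1 s (testPatch u φ x₀ r) →
    -I (testPatch u φ x₀ r) x₀ + H (u x₀) (gradient φ x₀) ≤ 0

/-- Viscosity supersolutions of `-I u + H(u, ∇u) = 0` in `ℝⁿ`, with the same convention on test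
functions as for subsolutions. -/
structure IsViscositySupersolution {n : ℕ} (s : ℝ)
    (I : (EuclideanSpace ℝ (Fin n) → ℝ) → EuclideanSpace ℝ (Fin n) → ℝ)
    (H : ℝ → EuclideanSpace ℝ (Fin n) → ℝ) (u : EuclideanSpace ℝ (Fin n) → ℝ) : Prop where
  measurable : Measurable u
  memWeightedL1 : MemWeightedL1 s u
  lowerSemicontinuous : LowerSemicontinuous u
  test : ∀ (x₀ : EuclideanSpace ℝ (Fin n)) (r : ℝ) (φ : EuclideanSpace ℝ (Fin n) → ℝ), 0 < r →
    ContDiffOn ℝ 2 φ (Metric.ball x₀ r) → u x₀ = φ x₀ → (∀ y ∈ Metric.ball x₀ r, φ y ≤ u y) →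
    MemWeightedL1 s (testPatch u φ x₀ r) →
    0 ≤ -I (testPatch u φ x₀ r) x₀ + H (u x₀) (gradient φ x₀)

/-- Viscosity solutions of `-I u + H(u, ∇u) = 0` in `ℝⁿ`. -/
def IsViscositySolution {n : ℕ} (s : ℝ)
    (I : (EuclideanSpace ℝ (Fin n) → ℝ) → EuclideanSpace ℝ (Fin n) → ℝ)
    (H : ℝ → EuclideanSpace ℝ (Fin n) → ℝ) (u : EuclideanSpace ℝ (Fin n) → ℝ) : Prop :=
  IsViscositySubsolution s I H u ∧ IsViscositySupersolution s I H u

/-! Write ψ(x) = (1+|x|²)^(σ/2), which is `bracketPow σ`. It serves as a penalty at infinity because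
L_K ψ is bounded above uniformly in x and K: for 0 ≤ σ < 1 over all kernels of the class
(`linOp_bracketPow_le`), for 0 ≤ σ < 2s over the symmetric ones (`linOp_bracketPow_le_of_symm`). A
multiple εψ with σ > γ dominates u at infinity, forces maxima to exist, and costs only εC in the
equation.

Sublinear growth. The Hamiltonian r^q |p|^m is homogeneous of degree q + m > 1, so for μ > 1 the
function μu satisfies the equation with the Hamiltonian multiplied by μ^(1-q-m) < 1. If u(x) > μu(y)
+ A|x-y| somewhere, the doubled function u(x) - μu(y) - A|x-y| - εψ(x) has a positive maximum,
attained off the diagonal. There the two gradients have length A up to ε, u(x) ≥ μu(y), and the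
nonlocal terms differ by at most εC (`IsViscositySolution.le_of_isMax_doubled`). The strict gap
between the Hamiltonians survives as ε → 0, since u(x) stays bounded below; this is a contradiction
(`IsViscositySolution.le_mul_add`). Letting μ → 1 and A → 0 gives u(x) ≤ u(y) for all x, y.

Growth of order γ in [1, 2s). Here the hypotheses are contradictory. If u(x) ≥ δR^γ at some |x| = R,
then u - εψ with γ < σ < 2s and ε of order R^(γ-σ) is maximal at a point whose norm is at least of
order R, and there |ε∇ψ|^m ≤ εC. This bounds R^((γ-1)(m-1)+(σ-1)), a positive power of R, so R
cannot be arbitrarily large (`limsup_nonpos_of_subsolution`). -/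

/-! ### Integrability against |z|^(-n-2s) and the weight ω_s -/

/-- The function `t ↦ t²` for `t < 1`, continued by `t ↦ t ^ σ`. -/
noncomputable def splitPow (σ t : ℝ) : ℝ := if t < 1 then t ^ 2 else t ^ σ

lemma splitPow_nonneg (σ : ℝ) {t : ℝ} (ht : 0 ≤ t) : 0 ≤ splitPow σ t := by
  unfold splitPow
  split_ifs <;> positivity

lemma measurable_splitPow (σ : ℝ) : Measurable (splitPow σ) :=
  Measurable.ite measurableSet_Iio (by fun_prop) (by fun_prop)

/-- In polar coordinates the radial density is t^(1-2s) on (0,1), integrable as s < 1, and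
t^(σ-1-2s) beyond 1, integrable as σ < 2s. -/
lemma integrable_splitPow_mul {n : ℕ} (hn : 0 < n) {s σ : ℝ} (hs1 : s < 1) (hσ : σ < 2 * s) :
    Integrable (fun z : EuclideanSpace ℝ (Fin n) =>
      splitPow σ ‖z‖ * ‖z‖ ^ (-((n : ℝ) + 2 * s))) := by
  have : Nonempty (Fin n) := ⟨⟨0, hn⟩⟩
  have h := integrable_fun_norm_addHaar (volume : Measure (EuclideanSpace ℝ (Fin n)))
    (f := fun t => splitPow σ t * t ^ (-((n : ℝ) + 2 * s)))
  refine h.2 ?_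
  simp only [finrank_euclideanSpace, Fintype.card_fin, smul_eq_mul]
  rw [← Set.Ioo_union_Ici_eq_Ioi (zero_lt_one (α := ℝ))]
  have hcast : ((n - 1 : ℕ) : ℝ) = (n : ℝ) - 1 := by
    rw [Nat.cast_sub hn]; simp
  refine IntegrableOn.union ?_ ?_
  · have h1 : IntegrableOn (fun t : ℝ => t ^ (1 - 2 * s)) (Set.Ioo 0 1) :=
      (intervalIntegral.integrableOn_Ioo_rpow_iff zero_lt_one).2 (by linarith)
    refine h1.congr_fun (fun t ht => ?_) measurableSet_Ioo
    have ht0 : 0 < t := ht.1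
    simp only [splitPow, if_pos ht.2]
    rw [← Real.rpow_natCast t (n - 1), ← Real.rpow_natCast t 2, ← Real.rpow_add ht0,
      ← Real.rpow_add ht0, hcast]
    congr 1
    push_cast
    ring
  · rw [integrableOn_Ici_iff_integrableOn_Ioi]
    have h1 : IntegrableOn (fun t : ℝ => t ^ (σ - 1 - 2 * s)) (Set.Ioi 1) :=
      integrableOn_Ioi_rpow_of_lt (by linarith) zero_lt_one
    refine h1.congr_fun (fun t ht => ?_) measurableSet_Ioi
    have ht1 : 1 < t := ht
    have ht0 : 0 < t := by linarith
    simp only [splitPow, if_neg (not_lt.2 ht1.le)]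
    rw [← Real.rpow_natCast t (n - 1), ← Real.rpow_add ht0,
      ← Real.rpow_add ht0, hcast]
    congr 1
    ring

lemma MemWeightedL1.const_mul {n : ℕ} {s : ℝ} {u : EuclideanSpace ℝ (Fin n) → ℝ}
    (hu : MemWeightedL1 s u) (t : ℝ) : MemWeightedL1 s (fun y => t * u y) := by
  have := Integrable.const_mul hu t
  simpa only [MemWeightedL1, mul_assoc] using this

lemma MemWeightedL1.aestronglyMeasurable {n : ℕ} {s : ℝ} {u : EuclideanSpace ℝ (Fin n) → ℝ}
    (hu : MemWeightedL1 s u) : AEStronglyMeasurable u := by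
  have h2 : Measurable (fun z : EuclideanSpace ℝ (Fin n) => (1 + ‖z‖) ^ ((n : ℝ) + 2 * s)) := by
    fun_prop
  refine ((Integrable.aestronglyMeasurable hu).mul h2.aestronglyMeasurable).congr
    (Eventually.of_forall fun z => ?_)
  have hz : 0 < 1 + ‖z‖ := by positivity
  simp only [Pi.mul_apply]
  rw [mul_assoc, ← Real.rpow_add hz]
  simp

lemma MemWeightedL1.comp_add_right {n : ℕ} {s : ℝ} (hs : 0 ≤ s) {u : EuclideanSpace ℝ (Fin n) → ℝ}
    (hu : MemWeightedL1 s u) (h : EuclideanSpace ℝ (Fin n)) :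
    MemWeightedL1 s (fun y => u (y + h)) := by
  have h1 := (Integrable.comp_add_right hu h).norm.const_mul ((1 + ‖h‖) ^ ((n : ℝ) + 2 * s))
  have hm : AEStronglyMeasurable (fun y => u (y + h)) :=
    hu.aestronglyMeasurable.comp_measurePreserving (measurePreserving_add_right volume h)
  have hw : Measurable (fun z : EuclideanSpace ℝ (Fin n) => (1 + ‖z‖) ^ (-((n : ℝ) + 2 * s))) := by
    fun_prop
  refine h1.mono' (hm.mul hw.aestronglyMeasurable) (Eventually.of_forall fun z => ?_)
  have hN : 0 ≤ (n : ℝ) + 2 * s := by positivity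
  have hz : 0 < 1 + ‖z‖ := by positivity
  have hzh : 0 < 1 + ‖z + h‖ := by positivity
  have hh : 0 < 1 + ‖h‖ := by positivity
  have key : (1 + ‖z‖) ^ (-((n : ℝ) + 2 * s)) ≤
      (1 + ‖h‖) ^ ((n : ℝ) + 2 * s) * (1 + ‖z + h‖) ^ (-((n : ℝ) + 2 * s)) := by
    rw [Real.rpow_neg hz.le, Real.rpow_neg hzh.le, ← div_eq_mul_inv, inv_eq_one_div,
      div_le_div_iff₀ (by positivity) (by positivity), one_mul, ← Real.mul_rpow hh.le hz.le]
    refine Real.rpow_le_rpow hzh.le ?_ hN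
    nlinarith [norm_add_le z h, norm_nonneg z, norm_nonneg h, mul_nonneg (norm_nonneg h)
      (norm_nonneg z)]
  simp only [norm_mul, Real.norm_eq_abs]
  rw [abs_of_pos (Real.rpow_pos_of_pos hz _), abs_of_pos (Real.rpow_pos_of_pos hzh _)]
  calc |u (z + h)| * (1 + ‖z‖) ^ (-((n : ℝ) + 2 * s))
      ≤ |u (z + h)| * ((1 + ‖h‖) ^ ((n : ℝ) + 2 * s) *
          (1 + ‖z + h‖) ^ (-((n : ℝ) + 2 * s))) := by gcongr
    _ = _ := by ring

lemma memWeightedL1_of_growth {n : ℕ} {s κ C : ℝ} {u : EuclideanSpace ℝ (Fin n) → ℝ}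
    (hm : Continuous u) (hκ : κ < 2 * s) (hu : ∀ z, |u z| ≤ C * (1 + ‖z‖) ^ κ) :
    MemWeightedL1 s u := by
  have h1 : Integrable (fun z : EuclideanSpace ℝ (Fin n) =>
      (1 + ‖z‖) ^ (-((n : ℝ) + 2 * s - κ))) :=
    integrable_one_add_norm (by simp; linarith)
  have hw : Measurable (fun z : EuclideanSpace ℝ (Fin n) => (1 + ‖z‖) ^ (-((n : ℝ) + 2 * s))) := by
    fun_prop
  refine (h1.const_mul C).mono' (hm.measurable.mul hw).aestronglyMeasurable
    (Eventually.of_forall fun z => ?_)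
  have hz : 0 < 1 + ‖z‖ := by positivity
  rw [norm_mul, Real.norm_eq_abs, Real.norm_eq_abs, abs_of_pos (Real.rpow_pos_of_pos hz _)]
  calc _ ≤ C * (1 + ‖z‖) ^ κ * (1 + ‖z‖) ^ (-((n : ℝ) + 2 * s)) := by
        gcongr; exact hu z
    _ = _ := by rw [mul_assoc, ← Real.rpow_add hz]; ring_nf

lemma MemWeightedL1.testPatch {n : ℕ} {s : ℝ} {u φ : EuclideanSpace ℝ (Fin n) → ℝ}
    (hu : MemWeightedL1 s u) (hφ : Continuous φ) (x₀ : EuclideanSpace ℝ (Fin n)) (r : ℝ) :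
    MemWeightedL1 s (testPatch u φ x₀ r) := by
  have hw : Continuous (fun z : EuclideanSpace ℝ (Fin n) =>
      (1 + ‖z‖) ^ (-((n : ℝ) + 2 * s))) := by
    refine Continuous.rpow_const (by fun_prop) fun z => Or.inl ?_
    positivity
  have h1 : IntegrableOn (fun z : EuclideanSpace ℝ (Fin n) =>
      φ z * (1 + ‖z‖) ^ (-((n : ℝ) + 2 * s))) (Metric.ball x₀ r) :=
    ((hφ.mul hw).continuousOn.integrableOn_compact (isCompact_closedBall x₀ r)).mono_set
      Metric.ball_subset_closedBall
  classical
  have h2 := Integrable.piecewise measurableSet_ball h1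
    (Integrable.integrableOn (s := (Metric.ball x₀ r)ᶜ) hu)
  refine h2.congr (Eventually.of_forall fun z => ?_)
  by_cases hz : dist z x₀ < r
  · simp [_root_.testPatch, Set.piecewise, hz]
  · simp [_root_.testPatch, Set.piecewise, hz]

/-! ### Pointwise C^{1,1} expansions -/

lemma IsC11At.hasGradientAt {n : ℕ} {u : EuclideanSpace ℝ (Fin n) → ℝ}
    {x p : EuclideanSpace ℝ (Fin n)} {C r : ℝ} (hr : 0 < r)
    (h : ∀ z, ‖z‖ < r → |u (x + z) - u x - inner ℝ p z| ≤ C * ‖z‖ ^ 2) :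
    HasGradientAt u p x := by
  rw [hasGradientAt_iff_isLittleO_nhds_zero]
  have h1 : (fun z : EuclideanSpace ℝ (Fin n) => u (x + z) - u x - inner ℝ p z)
      =O[𝓝 0] fun z => ‖z‖ ^ 2 := by
    refine Asymptotics.IsBigO.of_bound C ?_
    filter_upwards [Metric.ball_mem_nhds (0 : EuclideanSpace ℝ (Fin n)) hr] with z hz
    rw [Real.norm_eq_abs, norm_pow, norm_norm]
    exact h z (by simpa using hz)
  refine h1.trans_isLittleO ?_
  have := Asymptotics.isLittleO_norm_pow_id (E' := EuclideanSpace ℝ (Fin n)) one_lt_two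
  simpa using this

lemma IsC11At.congr {n : ℕ} {u v : EuclideanSpace ℝ (Fin n) → ℝ}
    {x : EuclideanSpace ℝ (Fin n)} (hu : IsC11At u x) (h : u =ᶠ[𝓝 x] v) : IsC11At v x := by
  obtain ⟨p, C, r, hr, H⟩ := hu
  obtain ⟨ρ, hρ, hb⟩ := Metric.eventually_nhds_iff_ball.1 h
  refine ⟨p, C, min r ρ, lt_min hr hρ, fun z hz => ?_⟩
  rw [← hb (x + z) (by simpa using hz.trans_le (min_le_right _ _)),
    ← hb x (Metric.mem_ball_self hρ)]
  exact H z (hz.trans_le (min_le_left _ _))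

lemma IsC11At.comp_add_right {n : ℕ} {u : EuclideanSpace ℝ (Fin n) → ℝ}
    {x h : EuclideanSpace ℝ (Fin n)} (hu : IsC11At u (x + h)) :
    IsC11At (fun y => u (y + h)) x := by
  obtain ⟨p, C, r, hr, H⟩ := hu
  exact ⟨p, C, r, hr, fun z hz => by simpa only [add_right_comm x z h] using H z hz⟩

lemma IsC11At.const_mul {n : ℕ} {u : EuclideanSpace ℝ (Fin n) → ℝ}
    {x : EuclideanSpace ℝ (Fin n)} (hu : IsC11At u x) (t : ℝ) :
    IsC11At (fun y => t * u y) x := by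
  obtain ⟨p, C, r, hr, H⟩ := hu
  refine ⟨t • p, |t| * C, r, hr, fun z hz => ?_⟩
  rw [real_inner_smul_left, ← mul_sub, ← mul_sub, abs_mul, mul_assoc]
  exact mul_le_mul_of_nonneg_left (H z hz) (abs_nonneg t)

lemma ContDiffAt.isC11At {n : ℕ} {u : EuclideanSpace ℝ (Fin n) → ℝ}
    {x : EuclideanSpace ℝ (Fin n)} (hu : ContDiffAt ℝ 2 u x) : IsC11At u x := by
  have h1 : ContDiffAt ℝ 1 (fderiv ℝ u) x := hu.fderiv_right (by norm_num)
  obtain ⟨K, t, ht, hK⟩ := h1.exists_lipschitzOnWith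
  have h2 : ∀ᶠ y in 𝓝 x, DifferentiableAt ℝ u y :=
    (hu.eventually (by simp)).mono fun y hy => hy.differentiableAt (by simp)
  obtain ⟨r, hr, hb⟩ := Metric.eventually_nhds_iff_ball.1 (h2.and ht)
  refine ⟨gradient u x, K, r, hr, fun z hz => ?_⟩
  rw [inner_gradient_left]
  have hsub : Metric.closedBall x ‖z‖ ⊆ Metric.ball x r := Metric.closedBall_subset_ball hz
  have := (convex_closedBall x ‖z‖).norm_image_sub_le_of_norm_hasFDerivWithin_le'
    (f := u) (f' := fderiv ℝ u) (φ := fderiv ℝ u x) (C := K * ‖z‖)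
    (fun y hy => (hb y (hsub hy)).1.hasFDerivAt.hasFDerivWithinAt)
    (fun y hy => by
      have h3 := hK.dist_le_mul y (hb y (hsub hy)).2 x (hb x (Metric.mem_ball_self hr)).2
      rw [dist_eq_norm] at h3
      refine h3.trans ?_
      gcongr
      exact hy)
    (x := x) (y := x + z) (Metric.mem_closedBall_self (norm_nonneg z)) (by simp)
  simpa [pow_two, mul_assoc] using this

/-! ### Linear operators and ellipticity -/

/-- The second order difference that is integrated against the kernel. -/
noncomputable def linIntegrand {n : ℕ} (u : EuclideanSpace ℝ (Fin n) → ℝ)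
    (x z : EuclideanSpace ℝ (Fin n)) : ℝ :=
  u (x + z) - u x - if ‖z‖ < 1 then inner ℝ (gradient u x) z else 0

lemma linOp_eq_integral {n : ℕ} {s : ℝ} (hs : 1 / 2 ≤ s) (hs1 : s < 1)
    (K u : EuclideanSpace ℝ (Fin n) → ℝ) (x : EuclideanSpace ℝ (Fin n)) :
    linOp s K u x = ∫ z, linIntegrand u x z * K z := by
  have h : 1 ≤ 2 * s ∧ 2 * s < 2 := ⟨by linarith, by linarith⟩
  simp only [linOp, linIntegrand, h, true_and, and_self]

lemma ae_ne_zero {n : ℕ} (hn : 0 < n) : ∀ᵐ z : EuclideanSpace ℝ (Fin n), z ≠ 0 := by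
  have : Nonempty (Fin n) := ⟨⟨0, hn⟩⟩
  exact compl_mem_ae_iff.2 (measure_singleton 0)

lemma kernel_nonneg {n : ℕ} {s lam Lam : ℝ} (hlam : 0 < lam) {K : EuclideanSpace ℝ (Fin n) → ℝ}
    (hK : K ∈ kernelClass n s lam Lam) {z : EuclideanSpace ℝ (Fin n)} (hz : z ≠ 0) : 0 ≤ K z :=
  le_trans (by positivity) (hK.2 z hz).1

lemma kernel_le {n : ℕ} {s lam Lam : ℝ} {K : EuclideanSpace ℝ (Fin n) → ℝ}
    (hK : K ∈ kernelClass n s lam Lam) {z : EuclideanSpace ℝ (Fin n)} (hz : z ≠ 0) :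
    K z ≤ Lam * ‖z‖ ^ (-((n : ℝ) + 2 * s)) := by
  rw [Real.rpow_neg (norm_nonneg z), ← div_eq_mul_inv]
  exact (hK.2 z hz).2

lemma symKernelClass_nonempty {n : ℕ} {s lam Lam : ℝ} (hLam : lam ≤ Lam) :
    (symKernelClass n s lam Lam).Nonempty := by
  refine ⟨fun z => lam / ‖z‖ ^ ((n : ℝ) + 2 * s), ⟨by fun_prop, fun z hz => ⟨le_rfl, ?_⟩⟩,
    fun z _ => by simp only [norm_neg]⟩
  exact div_le_div_of_nonneg_right hLam (by positivity)

lemma integrable_mul_kernel_of_le {n : ℕ} (hn : 0 < n) {s lam Lam : ℝ} (hlam : 0 < lam)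
    {K f g : EuclideanSpace ℝ (Fin n) → ℝ} (hK : K ∈ kernelClass n s lam Lam)
    (hf : AEStronglyMeasurable f)
    (hg : Integrable (fun z => g z * ‖z‖ ^ (-((n : ℝ) + 2 * s)))) (hfg : ∀ z, |f z| ≤ g z) :
    Integrable (fun z => f z * K z) := by
  refine (hg.const_mul Lam).mono' (hf.mul hK.1.aestronglyMeasurable) ?_
  filter_upwards [ae_ne_zero hn] with z hz
  rw [norm_mul, Real.norm_eq_abs, Real.norm_eq_abs, abs_of_nonneg (kernel_nonneg hlam hK hz)]
  calc |f z| * K z ≤ g z * (Lam * ‖z‖ ^ (-((n : ℝ) + 2 * s))) :=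
        mul_le_mul (hfg z) (kernel_le hK hz) (kernel_nonneg hlam hK hz)
          ((abs_nonneg _).trans (hfg z))
    _ = _ := by ring

lemma aestronglyMeasurable_linIntegrand {n : ℕ} {s : ℝ}
    {u : EuclideanSpace ℝ (Fin n) → ℝ} (hu : MemWeightedL1 s u) (x : EuclideanSpace ℝ (Fin n)) :
    AEStronglyMeasurable (linIntegrand u x) := by
  have h1 : AEStronglyMeasurable (fun z => u (x + z)) :=
    hu.aestronglyMeasurable.comp_measurePreserving (measurePreserving_add_left volume x)
  have h2 : Measurable (fun z : EuclideanSpace ℝ (Fin n) =>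
      if ‖z‖ < 1 then inner ℝ (gradient u x) z else 0) :=
    Measurable.ite (measurableSet_lt measurable_norm measurable_const) (by fun_prop) (by fun_prop)
  exact (h1.sub aestronglyMeasurable_const).sub h2.aestronglyMeasurable

/-- A Bochner integral that diverges is 0 by default, so splitting or comparing values of `linOp`
requires this. Near 0 the quadratic expansion compensates the singularity; away from 0 the kernel is
comparable to ω_s. -/
lemma integrable_linIntegrand_mul {n : ℕ} (hn : 0 < n) {s lam Lam : ℝ} (hs : 1 / 2 ≤ s)
    (hs1 : s < 1) (hlam : 0 < lam) {K u : EuclideanSpace ℝ (Fin n) → ℝ}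
    {x : EuclideanSpace ℝ (Fin n)} (hK : K ∈ kernelClass n s lam Lam) (hu : Admissible s u x) :
    Integrable (fun z => linIntegrand u x z * K z) := by
  obtain ⟨⟨p, C, r, hr, H⟩, hu1⟩ := hu
  have hp : gradient u x = p := (IsC11At.hasGradientAt hr H).gradient
  set ρ := min r 1 with hρ_def
  have hρ : 0 < ρ := lt_min hr one_pos
  set N := (n : ℝ) + 2 * s with hN_def
  have hN : 0 ≤ N := by positivity
  -- For |z| ≥ ρ one has 1 + |z| ≤ (1 + 1/ρ)|z|, hence |z|^(-N) ≤ a (1+|z|)^(-N).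
  set a : ℝ := (1 + 1 / ρ) ^ N with ha_def
  have ha : 0 ≤ a := by positivity
  have hN' : (Module.finrank ℝ (EuclideanSpace ℝ (Fin n)) : ℝ) < N := by
    simp [hN_def]; linarith
  have hshift : Integrable (fun z => u (z + x) * (1 + ‖z‖) ^ (-N)) :=
    hu1.comp_add_right (by linarith) x
  have hconst : Integrable (fun z : EuclideanSpace ℝ (Fin n) => (1 + ‖z‖) ^ (-N)) :=
    integrable_one_add_norm hN'
  have htail : ∀ z : EuclideanSpace ℝ (Fin n), ρ ≤ ‖z‖ →
      ‖z‖ ^ (-N) ≤ a * (1 + ‖z‖) ^ (-N) := by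
    intro z hz
    have hz0 : 0 < ‖z‖ := hρ.trans_le hz
    have hz1 : 0 < 1 + ‖z‖ := by positivity
    rw [Real.rpow_neg hz0.le, Real.rpow_neg hz1.le, ← div_eq_mul_inv, inv_eq_one_div,
      div_le_div_iff₀ (by positivity) (by positivity), one_mul, ha_def,
      ← Real.mul_rpow (by positivity) hz0.le]
    refine Real.rpow_le_rpow hz1.le ?_ hN
    have : 1 ≤ 1 / ρ * ‖z‖ := by
      rw [one_div, inv_mul_eq_div, le_div_iff₀ hρ]; linarith
    linarith
  have hB : Integrable (fun z => Lam * (|C| * (splitPow 0 ‖z‖ * ‖z‖ ^ (-N)) +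
      a * (‖u (z + x) * (1 + ‖z‖) ^ (-N)‖ + (|u x| + ‖p‖) * (1 + ‖z‖) ^ (-N)))) :=
    (((integrable_splitPow_mul hn hs1 (by linarith)).const_mul _).add
      ((hshift.norm.add (hconst.const_mul _)).const_mul a)).const_mul Lam
  refine hB.mono' ((aestronglyMeasurable_linIntegrand hu1 x).mul hK.1.aestronglyMeasurable) ?_
  filter_upwards [ae_ne_zero hn] with z hz
  have hz1 : 0 < 1 + ‖z‖ := by positivity
  have hK0 := kernel_nonneg hlam hK hz
  have hK1 : K z ≤ Lam * ‖z‖ ^ (-N) := kernel_le hK hz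
  have hsp : 0 ≤ splitPow 0 ‖z‖ := splitPow_nonneg 0 (norm_nonneg z)
  rw [norm_mul, Real.norm_eq_abs, Real.norm_eq_abs (K z), abs_of_nonneg hK0]
  have hLam : 0 ≤ Lam := by
    have h0 := hK0.trans hK1
    exact nonneg_of_mul_nonneg_left h0 (Real.rpow_pos_of_pos (norm_pos_iff.2 hz) _)
  have hpw : |linIntegrand u x z| * ‖z‖ ^ (-N) ≤ |C| * (splitPow 0 ‖z‖ * ‖z‖ ^ (-N)) +
      a * (‖u (z + x) * (1 + ‖z‖) ^ (-N)‖ + (|u x| + ‖p‖) * (1 + ‖z‖) ^ (-N)) := by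
    by_cases hzρ : ‖z‖ < ρ
    · have h1 : ‖z‖ < 1 := hzρ.trans_le (min_le_right _ _)
      have h2 : |linIntegrand u x z| ≤ |C| * splitPow 0 ‖z‖ := by
        simp only [linIntegrand, if_pos h1, hp, splitPow]
        exact (H z (hzρ.trans_le (min_le_left _ _))).trans
          (mul_le_mul_of_nonneg_right (le_abs_self C) (by positivity))
      calc _ ≤ |C| * splitPow 0 ‖z‖ * ‖z‖ ^ (-N) := by gcongr
        _ ≤ _ := by
          rw [mul_assoc]
          exact le_add_of_nonneg_right (by positivity)
    · have h2 : |linIntegrand u x z| ≤ |u (z + x)| + (|u x| + ‖p‖) := by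
        have h3 : |if ‖z‖ < 1 then inner ℝ (gradient u x) z else (0 : ℝ)| ≤ ‖p‖ := by
          split_ifs with h
          · rw [hp]
            exact (abs_real_inner_le_norm p z).trans
              (mul_le_of_le_one_right (norm_nonneg p) h.le)
          · simp
        rw [add_comm z x, linIntegrand]
        have h4 := abs_sub (u (x + z) - u x) (if ‖z‖ < 1 then inner ℝ (gradient u x) z else (0 : ℝ))
        have h5 := abs_sub (u (x + z)) (u x)
        linarith
      calc _ ≤ (|u (z + x)| + (|u x| + ‖p‖)) * (a * (1 + ‖z‖) ^ (-N)) := by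
            gcongr
            exact htail z (not_lt.1 hzρ)
        _ = a * (‖u (z + x) * (1 + ‖z‖) ^ (-N)‖ + (|u x| + ‖p‖) * (1 + ‖z‖) ^ (-N)) := by
            rw [norm_mul, Real.norm_eq_abs, Real.norm_of_nonneg (Real.rpow_nonneg hz1.le _)]
            ring
        _ ≤ _ := le_add_of_nonneg_left (by positivity)
  calc _ ≤ |linIntegrand u x z| * (Lam * ‖z‖ ^ (-N)) := by gcongr
    _ = Lam * (|linIntegrand u x z| * ‖z‖ ^ (-N)) := by ring
    _ ≤ _ := by gcongr

lemma linOp_sub_le {n : ℕ} (hn : 0 < n) {s lam Lam : ℝ} (hs : 1 / 2 ≤ s)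
    (hs1 : s < 1) (hlam : 0 < lam) {K v w f : EuclideanSpace ℝ (Fin n) → ℝ}
    {x y : EuclideanSpace ℝ (Fin n)} (hK : K ∈ kernelClass n s lam Lam) (hv : Admissible s v x)
    (hw : Admissible s w y) (hf : Integrable (fun z => f z * K z))
    (h : ∀ z, linIntegrand v x z - linIntegrand w y z ≤ f z) :
    linOp s K v x - linOp s K w y ≤ ∫ z, f z * K z := by
  have h1 := integrable_linIntegrand_mul hn hs hs1 hlam hK hv
  have h2 := integrable_linIntegrand_mul hn hs hs1 hlam hK hw
  rw [linOp_eq_integral hs hs1, linOp_eq_integral hs hs1, ← integral_sub h1 h2]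
  refine integral_mono_ae (h1.sub h2) hf ?_
  filter_upwards [ae_ne_zero hn] with z hz
  simp only [← sub_mul]
  exact mul_le_mul_of_nonneg_right (h z) (kernel_nonneg hlam hK hz)

lemma gradient_comp_add_right {n : ℕ} (u : EuclideanSpace ℝ (Fin n) → ℝ)
    (x h : EuclideanSpace ℝ (Fin n)) :
    gradient (fun y => u (y + h)) x = gradient u (x + h) := by
  simp only [gradient, fderiv_comp_add_right]

lemma linOp_comp_add_right {n : ℕ} (s : ℝ) (K u : EuclideanSpace ℝ (Fin n) → ℝ)
    (x h : EuclideanSpace ℝ (Fin n)) :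
    linOp s K (fun y => u (y + h)) x = linOp s K u (x + h) := by
  simp only [linOp, gradient_comp_add_right, add_right_comm x _ h]

/-- Ellipticity compares two functions at one point; translating v by x - y turns it into a
comparison at two different points, as doubling of variables needs. A uniform bound over a nonempty
class suffices to bound the supremum. -/
lemma IsEllipticOperator.sub_le {n : ℕ} {s : ℝ} (hs : 0 ≤ s)
    {𝒦 : Set (EuclideanSpace ℝ (Fin n) → ℝ)}
    {I : (EuclideanSpace ℝ (Fin n) → ℝ) → EuclideanSpace ℝ (Fin n) → ℝ}
    (hI : IsEllipticOperator s 𝒦 I) (h𝒦 : 𝒦.Nonempty)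
    {v w : EuclideanSpace ℝ (Fin n) → ℝ} {x y : EuclideanSpace ℝ (Fin n)}
    (hv : Admissible s v x) (hw : Admissible s w y) {B : ℝ}
    (h : ∀ K ∈ 𝒦, linOp s K v x - linOp s K w y ≤ B) : I v x - I w y ≤ B := by
  have hxy : y + (x - y) = x := by abel
  have hv' : Admissible s v (y + (x - y)) := by rwa [hxy]
  have hsh : Admissible s (fun z => v (z + (x - y))) y :=
    ⟨hv'.1.comp_add_right, hv'.2.comp_add_right hs _⟩
  have h1 := (hI.elliptic _ _ y hsh hw).2
  rw [hI.translation_invariant v y (x - y) hv', hxy] at h1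
  have := h𝒦.to_subtype
  refine h1.trans (ciSup_le fun K => ?_)
  rw [linOp_comp_add_right, hxy]
  exact h K.1 K.2

lemma IsEllipticOperator.apply_zero {n : ℕ} {s : ℝ}
    {𝒦 : Set (EuclideanSpace ℝ (Fin n) → ℝ)}
    {I : (EuclideanSpace ℝ (Fin n) → ℝ) → EuclideanSpace ℝ (Fin n) → ℝ}
    (hI : IsEllipticOperator s 𝒦 I) (x : EuclideanSpace ℝ (Fin n)) : I (fun _ => 0) x = 0 := by
  have h0 : Admissible s (fun _ : EuclideanSpace ℝ (Fin n) => (0 : ℝ)) x :=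
    ⟨⟨0, 0, 1, one_pos, by simp⟩, by simp [MemWeightedL1]⟩
  have := hI.pos_homogeneous _ x 2 two_pos h0
  simp only [mul_zero] at this
  linarith

/-! ### The penalty function (1+|x|²)^(σ/2) -/

lemma rpow_add_le_tangent {t h a : ℝ} (ht : 0 < t) (hth : 0 ≤ t + h) (ha : 0 ≤ a) (ha1 : a ≤ 1) :
    (t + h) ^ a ≤ t ^ a + a * t ^ (a - 1) * h := by
  have h1 : -1 ≤ h / t := by rw [le_div_iff₀ ht]; linarith
  have h2 := rpow_one_add_le_one_add_mul_self h1 ha ha1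
  have h3 : t + h = t * (1 + h / t) := by field_simp
  rw [h3, Real.mul_rpow ht.le (by linarith)]
  calc t ^ a * (1 + h / t) ^ a ≤ t ^ a * (1 + a * (h / t)) := by gcongr
    _ = _ := by rw [Real.rpow_sub_one ht.ne']; field_simp

/-- The function `x ↦ (1 + |x|²) ^ (σ / 2)`. -/
noncomputable def bracketPow {n : ℕ} (σ : ℝ) (x : EuclideanSpace ℝ (Fin n)) : ℝ :=
  (1 + ‖x‖ ^ 2) ^ (σ / 2)

section bracketPow

variable {n : ℕ} {σ : ℝ}

lemma bracketPow_pos (x : EuclideanSpace ℝ (Fin n)) : 0 < bracketPow σ x :=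
  Real.rpow_pos_of_pos (by positivity) _

lemma contDiff_bracketPow : ContDiff ℝ 2 (bracketPow σ : EuclideanSpace ℝ (Fin n) → ℝ) := by
  unfold bracketPow
  refine ContDiff.rpow_const_of_ne ?_ fun x => by positivity
  exact contDiff_const.add (contDiff_norm_sq ℝ)

lemma continuous_bracketPow : Continuous (bracketPow σ : EuclideanSpace ℝ (Fin n) → ℝ) :=
  contDiff_bracketPow.continuous

lemma bracketPow_le (hσ : 0 ≤ σ) (x : EuclideanSpace ℝ (Fin n)) :
    bracketPow σ x ≤ (1 + ‖x‖) ^ σ := by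
  have h : (1 + ‖x‖) ^ σ = ((1 + ‖x‖) ^ 2) ^ (σ / 2) := by
    rw [← Real.rpow_natCast, ← Real.rpow_mul (by positivity)]
    congr 1
    push_cast
    ring
  rw [h]
  exact Real.rpow_le_rpow (by positivity) (by nlinarith [norm_nonneg x]) (by positivity)

lemma le_two_mul_bracketPow (hσ : 0 ≤ σ) (hσ2 : σ ≤ 2) (x : EuclideanSpace ℝ (Fin n)) :
    (1 + ‖x‖) ^ σ ≤ 2 * bracketPow σ x := by
  have h : (1 + ‖x‖) ^ σ = ((1 + ‖x‖) ^ 2) ^ (σ / 2) := by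
    rw [← Real.rpow_natCast, ← Real.rpow_mul (by positivity)]
    congr 1
    push_cast
    ring
  rw [h]
  calc _ ≤ (2 * (1 + ‖x‖ ^ 2)) ^ (σ / 2) :=
        Real.rpow_le_rpow (by positivity) (by nlinarith [sq_nonneg (1 - ‖x‖)]) (by positivity)
    _ = 2 ^ (σ / 2) * bracketPow σ x := by
        rw [Real.mul_rpow (by positivity) (by positivity)]; rfl
    _ ≤ _ := by
        refine mul_le_mul_of_nonneg_right ?_ (bracketPow_pos x).le
        calc (2 : ℝ) ^ (σ / 2) ≤ 2 ^ (1 : ℝ) :=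
              Real.rpow_le_rpow_of_exponent_le one_le_two (by linarith)
          _ = 2 := Real.rpow_one 2

lemma hasGradientAt_bracketPow (x : EuclideanSpace ℝ (Fin n)) :
    HasGradientAt (bracketPow σ) ((σ * (1 + ‖x‖ ^ 2) ^ (σ / 2 - 1)) • x) x := by
  rw [hasGradientAt_iff_hasFDerivAt]
  have h1 : HasFDerivAt (fun y : EuclideanSpace ℝ (Fin n) => 1 + ‖y‖ ^ 2)
      (2 • (innerSL ℝ x)) x := (hasStrictFDerivAt_norm_sq x).hasFDerivAt.const_add 1
  have h2 := h1.rpow_const (p := σ / 2) (Or.inl (by positivity))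
  refine h2.congr_fderiv ?_
  ext z
  simp only [smul_apply, innerSL_apply_apply, InnerProductSpace.toDual_apply_apply,
    real_inner_smul_left, smul_eq_mul, nsmul_eq_mul]
  push_cast
  ring

lemma gradient_bracketPow (x : EuclideanSpace ℝ (Fin n)) :
    gradient (bracketPow σ) x = (σ * (1 + ‖x‖ ^ 2) ^ (σ / 2 - 1)) • x :=
  (hasGradientAt_bracketPow x).gradient

lemma norm_gradient_bracketPow_le_one (hσ : 0 ≤ σ) (hσ1 : σ ≤ 1) (x : EuclideanSpace ℝ (Fin n)) :
    ‖gradient (bracketPow σ) x‖ ≤ 1 := by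
  have ht : 1 ≤ 1 + ‖x‖ ^ 2 := by nlinarith [sq_nonneg ‖x‖]
  rw [gradient_bracketPow, norm_smul, Real.norm_of_nonneg (by positivity)]
  have h1 : ‖x‖ ≤ (1 + ‖x‖ ^ 2) ^ (1 / 2 : ℝ) := by
    rw [← Real.sqrt_eq_rpow]
    exact Real.le_sqrt_of_sq_le (by linarith)
  calc σ * (1 + ‖x‖ ^ 2) ^ (σ / 2 - 1) * ‖x‖
      ≤ 1 * (1 + ‖x‖ ^ 2) ^ (-(1 / 2) : ℝ) * (1 + ‖x‖ ^ 2) ^ (1 / 2 : ℝ) := by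
        gcongr
        linarith
    _ = 1 := by rw [one_mul, ← Real.rpow_add (by positivity)]; simp

/-- The concave power t^(σ/2) lies below its tangent at t = 1 + |x|². In the increment 2⟨x,z⟩ + |z|²
the first term reproduces the gradient, and the second has a coefficient at most 1. -/
lemma bracketPow_add_sub_le (hσ : 0 ≤ σ) (hσ2 : σ ≤ 2) (x z : EuclideanSpace ℝ (Fin n)) :
    bracketPow σ (x + z) - bracketPow σ x - inner ℝ (gradient (bracketPow σ) x) z ≤ ‖z‖ ^ 2 := by
  have ht : 1 ≤ 1 + ‖x‖ ^ 2 := by nlinarith [sq_nonneg ‖x‖]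
  have he : 1 + ‖x + z‖ ^ 2 = (1 + ‖x‖ ^ 2) + (2 * inner ℝ x z + ‖z‖ ^ 2) := by
    rw [norm_add_sq_real]; ring
  have h1 := rpow_add_le_tangent (t := 1 + ‖x‖ ^ 2) (h := 2 * inner ℝ x z + ‖z‖ ^ 2) (a := σ / 2)
    (by positivity) (by rw [← he]; positivity) (by positivity) (by linarith)
  rw [← he] at h1
  have h2 : (1 + ‖x‖ ^ 2) ^ (σ / 2 - 1) ≤ 1 :=
    Real.rpow_le_one_of_one_le_of_nonpos ht (by linarith)
  have h3 : σ / 2 * (1 + ‖x‖ ^ 2) ^ (σ / 2 - 1) ≤ 1 :=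
    mul_le_one₀ (by linarith) (by positivity) h2
  rw [gradient_bracketPow, real_inner_smul_left]
  unfold bracketPow
  nlinarith [mul_le_mul_of_nonneg_right h3 (sq_nonneg ‖z‖)]

/-- √(1+|x|²) is 1-Lipschitz and t^σ is subadditive for σ ≤ 1. -/
lemma bracketPow_add_sub_le_rpow (hσ : 0 ≤ σ) (hσ1 : σ ≤ 1) (x z : EuclideanSpace ℝ (Fin n)) :
    bracketPow σ (x + z) - bracketPow σ x ≤ ‖z‖ ^ σ := by
  have he : ∀ y : EuclideanSpace ℝ (Fin n), bracketPow σ y = (√(1 + ‖y‖ ^ 2)) ^ σ := fun y => by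
    rw [bracketPow, Real.sqrt_eq_rpow, ← Real.rpow_mul (by positivity)]
    congr 1
    ring
  have h1 : √(1 + ‖x + z‖ ^ 2) ≤ √(1 + ‖x‖ ^ 2) + ‖z‖ := by
    rw [Real.sqrt_le_left (by positivity)]
    have h2 : ‖x‖ ≤ √(1 + ‖x‖ ^ 2) := Real.le_sqrt_of_sq_le (by linarith)
    have h3 : √(1 + ‖x‖ ^ 2) ^ 2 = 1 + ‖x‖ ^ 2 := Real.sq_sqrt (by positivity)
    nlinarith [norm_add_le x z, norm_nonneg z, norm_nonneg x, norm_nonneg (x + z),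
      mul_le_mul_of_nonneg_right h2 (norm_nonneg z)]
  rw [he, he, sub_le_iff_le_add']
  exact (Real.rpow_le_rpow (by positivity) h1 hσ).trans
    (Real.rpow_add_le_add_rpow (by positivity) (norm_nonneg z) hσ hσ1)

/-- For |z| ≥ 1 both values are compared with the tangent at 1 + |x|² + |z|², the mean of 1 + |x+z|²
and 1 + |x-z|². The linear terms cancel, and subadditivity of t^(σ/2) leaves 2|z|^σ. No first order
term remains, which is what allows σ > 1. -/
lemma bracketPow_second_difference_le (hσ : 0 ≤ σ) (hσ2 : σ ≤ 2)
    (x z : EuclideanSpace ℝ (Fin n)) :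
    bracketPow σ (x + z) + bracketPow σ (x - z) - 2 * bracketPow σ x ≤ 2 * splitPow σ ‖z‖ := by
  unfold splitPow
  split_ifs with hz
  · have h1 := bracketPow_add_sub_le hσ hσ2 x z
    have h2 := bracketPow_add_sub_le hσ hσ2 x (-z)
    rw [inner_neg_right, norm_neg, ← sub_eq_add_neg] at h2
    linarith
  · have hm : 0 < 1 + ‖x‖ ^ 2 + ‖z‖ ^ 2 := by positivity
    have e1 : 1 + ‖x + z‖ ^ 2 = (1 + ‖x‖ ^ 2 + ‖z‖ ^ 2) + 2 * inner ℝ x z := by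
      rw [norm_add_sq_real]; ring
    have e2 : 1 + ‖x - z‖ ^ 2 = (1 + ‖x‖ ^ 2 + ‖z‖ ^ 2) + -(2 * inner ℝ x z) := by
      rw [norm_sub_sq_real]; ring
    have h1 := rpow_add_le_tangent hm (h := 2 * inner ℝ x z) (a := σ / 2)
      (by rw [← e1]; positivity) (by positivity) (by linarith)
    have h2 := rpow_add_le_tangent hm (h := -(2 * inner ℝ x z)) (a := σ / 2)
      (by rw [← e2]; positivity) (by positivity) (by linarith)
    rw [← e1] at h1
    rw [← e2] at h2
    have h3 := Real.rpow_add_le_add_rpow (p := σ / 2) (a := 1 + ‖x‖ ^ 2) (b := ‖z‖ ^ 2)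
      (by positivity) (by positivity) (by positivity) (by linarith)
    have h4 : (‖z‖ ^ 2) ^ (σ / 2) = ‖z‖ ^ σ := by
      rw [← Real.rpow_natCast, ← Real.rpow_mul (by positivity)]
      congr 1
      push_cast
      ring
    rw [h4] at h3
    unfold bracketPow
    linarith

lemma linIntegrand_bracketPow_le (hσ : 0 ≤ σ) (hσ1 : σ ≤ 1) (x z : EuclideanSpace ℝ (Fin n)) :
    linIntegrand (bracketPow σ) x z ≤ splitPow σ ‖z‖ := by
  unfold linIntegrand splitPow
  split_ifs with h
  · exact bracketPow_add_sub_le hσ (by linarith) x z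
  · rw [sub_zero]
    exact bracketPow_add_sub_le_rpow hσ hσ1 x z

lemma admissible_bracketPow {s : ℝ} (hσ : 0 ≤ σ) (hσs : σ < 2 * s)
    (x : EuclideanSpace ℝ (Fin n)) : Admissible s (bracketPow σ) x := by
  refine ⟨contDiff_bracketPow.contDiffAt.isC11At,
    memWeightedL1_of_growth (C := 1) continuous_bracketPow hσs fun z => ?_⟩
  rw [abs_of_pos (bracketPow_pos z), one_mul]
  exact bracketPow_le hσ z

end bracketPow

/-! ### Uniform bounds for L_K on the penalty function -/

lemma integral_mul_kernel_le {n : ℕ} (hn : 0 < n) {s lam Lam : ℝ} (hlam : 0 < lam)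
    {K g : EuclideanSpace ℝ (Fin n) → ℝ} (hK : K ∈ kernelClass n s lam Lam) (hg0 : ∀ z, 0 ≤ g z)
    (hgm : AEStronglyMeasurable g)
    (hg : Integrable (fun z => g z * ‖z‖ ^ (-((n : ℝ) + 2 * s)))) :
    ∫ z, g z * K z ≤ Lam * ∫ z, g z * ‖z‖ ^ (-((n : ℝ) + 2 * s)) := by
  rw [← integral_const_mul]
  refine integral_mono_ae (integrable_mul_kernel_of_le hn hlam hK hgm hg
    fun z => (abs_of_nonneg (hg0 z)).le) (hg.const_mul Lam) ?_
  filter_upwards [ae_ne_zero hn] with z hz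
  calc g z * K z ≤ g z * (Lam * ‖z‖ ^ (-((n : ℝ) + 2 * s))) :=
        mul_le_mul_of_nonneg_left (kernel_le hK hz) (hg0 z)
    _ = _ := by ring

lemma integral_splitPow_mul_kernel_le {n : ℕ} (hn : 0 < n) {s lam Lam σ : ℝ} (hs1 : s < 1)
    (hlam : 0 < lam) (hσs : σ < 2 * s) {K : EuclideanSpace ℝ (Fin n) → ℝ}
    (hK : K ∈ kernelClass n s lam Lam) :
    Integrable (fun z => splitPow σ ‖z‖ * K z) ∧ ∫ z, splitPow σ ‖z‖ * K z ≤
      Lam * ∫ z : EuclideanSpace ℝ (Fin n), splitPow σ ‖z‖ * ‖z‖ ^ (-((n : ℝ) + 2 * s)) := by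
  have hm : AEStronglyMeasurable (fun z : EuclideanSpace ℝ (Fin n) => splitPow σ ‖z‖) :=
    ((measurable_splitPow σ).comp measurable_norm).aestronglyMeasurable
  have hi := integrable_splitPow_mul hn hs1 hσs
  have h0 : ∀ z : EuclideanSpace ℝ (Fin n), 0 ≤ splitPow σ ‖z‖ :=
    fun z => splitPow_nonneg σ (norm_nonneg z)
  exact ⟨integrable_mul_kernel_of_le hn hlam hK hm hi fun z => (abs_of_nonneg (h0 z)).le,
    integral_mul_kernel_le hn hlam hK h0 hm hi⟩

lemma linOp_bracketPow_le {n : ℕ} (hn : 0 < n) {s lam Lam σ : ℝ} (hs : 1 / 2 ≤ s) (hs1 : s < 1)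
    (hlam : 0 < lam) (hσ : 0 ≤ σ) (hσ1 : σ < 1) {K : EuclideanSpace ℝ (Fin n) → ℝ}
    (hK : K ∈ kernelClass n s lam Lam) (x : EuclideanSpace ℝ (Fin n)) :
    linOp s K (bracketPow σ) x ≤
      Lam * ∫ z : EuclideanSpace ℝ (Fin n), splitPow σ ‖z‖ * ‖z‖ ^ (-((n : ℝ) + 2 * s)) := by
  obtain ⟨h1, h2⟩ := integral_splitPow_mul_kernel_le hn hs1 hlam (σ := σ) (by linarith) hK
  rw [linOp_eq_integral hs hs1]
  refine le_trans ?_ h2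
  refine integral_mono_ae (integrable_linIntegrand_mul hn hs hs1 hlam hK
    (admissible_bracketPow hσ (by linarith) x)) h1 ?_
  filter_upwards [ae_ne_zero hn] with z hz
  exact mul_le_mul_of_nonneg_right (linIntegrand_bracketPow_le hσ hσ1.le x z)
    (kernel_nonneg hlam hK hz)

/-- Averaging the integral with its image under z ↦ -z replaces the integrand by half a second
difference, since K is even and the gradient term is odd. -/
lemma linOp_bracketPow_le_of_symm {n : ℕ} (hn : 0 < n) {s lam Lam σ : ℝ} (hs : 1 / 2 ≤ s)
    (hs1 : s < 1) (hlam : 0 < lam) (hσ : 0 ≤ σ) (hσs : σ < 2 * s)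
    {K : EuclideanSpace ℝ (Fin n) → ℝ} (hK : K ∈ symKernelClass n s lam Lam)
    (x : EuclideanSpace ℝ (Fin n)) :
    linOp s K (bracketPow σ) x ≤
      Lam * ∫ z : EuclideanSpace ℝ (Fin n), splitPow σ ‖z‖ * ‖z‖ ^ (-((n : ℝ) + 2 * s)) := by
  obtain ⟨h1, h2⟩ := integral_splitPow_mul_kernel_le hn hs1 hlam hσs hK.1
  have hi := integrable_linIntegrand_mul hn hs hs1 hlam hK.1
    (admissible_bracketPow (n := n) hσ hσs x)
  have hi' := hi.comp_neg
  have heq := integral_neg_eq_self (fun z => linIntegrand (bracketPow σ) x z * K z) volume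
  have hle := integral_mono_ae (hi.add hi') (h1.const_mul 2) (by
    filter_upwards [ae_ne_zero hn] with z hz
    simp only [Pi.add_apply]
    rw [← hK.2 z hz, ← add_mul, ← mul_assoc]
    refine mul_le_mul_of_nonneg_right ?_ (kernel_nonneg hlam hK.1 hz)
    refine le_trans (le_of_eq ?_) (bracketPow_second_difference_le hσ (by linarith) x z)
    simp only [linIntegrand, norm_neg, inner_neg_right, ← sub_eq_add_neg]
    split_ifs <;> ring)
  rw [integral_add' hi hi', heq, integral_const_mul] at hle
  rw [linOp_eq_integral hs hs1]
  linarith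

lemma eventually_le_mul_bracketPow {n : ℕ} {σ γ M ε : ℝ} (hσ : 0 ≤ σ) (hσ2 : σ ≤ 2)
    (hγ : γ < σ) (hε : 0 < ε) {u : EuclideanSpace ℝ (Fin n) → ℝ}
    (hu : ∀ x, u x ≤ M * (1 + ‖x‖) ^ γ) :
    ∀ᶠ x in cocompact (EuclideanSpace ℝ (Fin n)), u x ≤ ε * bracketPow σ x := by
  have h1 : Tendsto (fun x : EuclideanSpace ℝ (Fin n) => 1 + ‖x‖) (cocompact _) atTop :=
    tendsto_atTop_add_const_left _ _ (tendsto_norm_cocompact_atTop)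
  have h2 := ((tendsto_rpow_neg_atTop (sub_pos.2 hγ)).comp h1).const_mul M
  rw [mul_zero] at h2
  filter_upwards [h2.eventually_lt_const (half_pos hε)] with x hx
  have hx0 : 0 < 1 + ‖x‖ := by positivity
  simp only [Function.comp_apply] at hx
  calc u x ≤ M * (1 + ‖x‖) ^ γ := hu x
    _ = M * (1 + ‖x‖) ^ (-(σ - γ)) * (1 + ‖x‖) ^ σ := by
        rw [mul_assoc, ← Real.rpow_add hx0]; ring_nf
    _ ≤ ε / 2 * (2 * bracketPow σ x) := by
        gcongr
        exact le_two_mul_bracketPow hσ hσ2 x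
    _ = _ := by ring

/-! ### Test functions and penalised maxima of subsolutions -/

lemma testPatch_eventuallyEq {n : ℕ} (u φ : EuclideanSpace ℝ (Fin n) → ℝ)
    (x₀ : EuclideanSpace ℝ (Fin n)) {r : ℝ} (hr : 0 < r) : φ =ᶠ[𝓝 x₀] testPatch u φ x₀ r := by
  filter_upwards [Metric.ball_mem_nhds x₀ hr] with y hy
  exact (if_pos hy).symm

lemma gradient_testPatch {n : ℕ} (u φ : EuclideanSpace ℝ (Fin n) → ℝ)
    (x₀ : EuclideanSpace ℝ (Fin n)) {r : ℝ} (hr : 0 < r) :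
    gradient (testPatch u φ x₀ r) x₀ = gradient φ x₀ :=
  (testPatch_eventuallyEq u φ x₀ hr).gradient_eq.symm

lemma admissible_testPatch {n : ℕ} {s : ℝ} {u φ : EuclideanSpace ℝ (Fin n) → ℝ}
    {x₀ : EuclideanSpace ℝ (Fin n)} {r : ℝ} (hr : 0 < r) (hu : MemWeightedL1 s u)
    (hφ : Continuous φ) (hφ2 : ContDiffAt ℝ 2 φ x₀) : Admissible s (testPatch u φ x₀ r) x₀ :=
  ⟨hφ2.isC11At.congr (testPatch_eventuallyEq u φ x₀ hr), hu.testPatch hφ x₀ r⟩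

/-- The penalty, shifted to touch u from above at x₀, is a test function. The patched function stays
below it everywhere with the same value and gradient at x₀, so its L_K is at most εL_K ψ ≤ εC;
comparing with the zero function transfers this to I. -/
lemma IsViscositySubsolution.le_of_isMax_sub_bracketPow {n : ℕ} (hn : 0 < n) {s lam Lam σ ε C : ℝ}
    (hs : 1 / 2 ≤ s) (hs1 : s < 1) (hlam : 0 < lam) (hσ : 0 ≤ σ) (hσs : σ < 2 * s) (hε : 0 < ε)
    {𝒦 : Set (EuclideanSpace ℝ (Fin n) → ℝ)} (h𝒦 : 𝒦 ⊆ kernelClass n s lam Lam)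
    (h𝒦0 : 𝒦.Nonempty)
    {I : (EuclideanSpace ℝ (Fin n) → ℝ) → EuclideanSpace ℝ (Fin n) → ℝ}
    (hI : IsEllipticOperator s 𝒦 I) {H : ℝ → EuclideanSpace ℝ (Fin n) → ℝ}
    {u : EuclideanSpace ℝ (Fin n) → ℝ} (hu : IsViscositySubsolution s I H u)
    {x₀ : EuclideanSpace ℝ (Fin n)} (hC : ∀ K ∈ 𝒦, linOp s K (bracketPow σ) x₀ ≤ C)
    (hmax : ∀ x, u x - ε * bracketPow σ x ≤ u x₀ - ε * bracketPow σ x₀) :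
    H (u x₀) (ε • gradient (bracketPow σ) x₀) ≤ ε * C := by
  set φ : EuclideanSpace ℝ (Fin n) → ℝ :=
    fun y => u x₀ + ε * (bracketPow σ y - bracketPow σ x₀) with hφ
  have hφ2 : ContDiff ℝ 2 φ :=
    contDiff_const.add (contDiff_const.mul (contDiff_bracketPow.sub contDiff_const))
  have hgrad : gradient φ x₀ = ε • gradient (bracketPow σ) x₀ := by
    refine HasGradientAt.gradient ?_
    rw [hasGradientAt_iff_hasFDerivAt, gradient_bracketPow, map_smul]
    exact (((hasGradientAt_bracketPow x₀).hasFDerivAt.sub_const _).const_mul ε).const_add _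
  have hle : ∀ y, u y ≤ φ y := fun y => by
    have := hmax y
    simp only [hφ]
    linarith
  set v := testPatch u φ x₀ 1 with hv
  have hva : Admissible s v x₀ :=
    admissible_testPatch one_pos hu.memWeightedL1 hφ2.continuous hφ2.contDiffAt
  have htest := hu.test x₀ 1 φ one_pos hφ2.contDiffOn (by simp [hφ]) (fun y _ => hle y) hva.2
  rw [hgrad] at htest
  have h0 : Admissible s (fun _ : EuclideanSpace ℝ (Fin n) => (0 : ℝ)) x₀ :=
    ⟨⟨0, 0, 1, one_pos, by simp⟩, by simp [MemWeightedL1]⟩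
  have hv0 : v x₀ = u x₀ := by simp [hv, testPatch, hφ]
  have hvle : ∀ y, v y ≤ φ y := fun y => by
    simp only [hv, testPatch]
    split_ifs
    · exact le_rfl
    · exact hle y
  have hvg : gradient v x₀ = ε • gradient (bracketPow σ) x₀ := by
    rw [hv, gradient_testPatch u φ x₀ one_pos, hgrad]
  have key : I v x₀ - I (fun _ => 0) x₀ ≤ ε * C := by
    refine hI.sub_le (by linarith) h𝒦0 hva h0 fun K hK => ?_
    have hint := integrable_linIntegrand_mul hn hs hs1 hlam (h𝒦 hK)
      (admissible_bracketPow (n := n) hσ hσs x₀)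
    refine (linOp_sub_le hn hs hs1 hlam (h𝒦 hK) hva h0
      (f := fun z => ε * linIntegrand (bracketPow σ) x₀ z) ?_ fun z => ?_).trans ?_
    · simpa only [mul_assoc] using hint.const_mul ε
    · have h1 := hvle (x₀ + z)
      simp only [hφ] at h1
      simp only [linIntegrand, hvg, hv0, gradient_fun_const, inner_zero_left, ite_self,
        real_inner_smul_left]
      split_ifs <;> linarith
    · simp only [mul_assoc]
      rw [integral_const_mul, ← linOp_eq_integral hs hs1]
      exact mul_le_mul_of_nonneg_left (hC K hK) hε.le
  rw [hI.apply_zero] at key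
  change I v x₀ - 0 ≤ _ at key
  linarith

lemma le_norm_gradient_bracketPow {n : ℕ} {σ : ℝ} (hσ : 1 ≤ σ) (hσ2 : σ ≤ 2)
    {x : EuclideanSpace ℝ (Fin n)} (hx : 1 ≤ ‖x‖) :
    1 / 2 * (1 + ‖x‖) ^ (σ - 1) ≤ ‖gradient (bracketPow σ) x‖ := by
  rw [gradient_bracketPow, norm_smul, Real.norm_of_nonneg (by positivity)]
  have h1 : (1 + ‖x‖) ^ (σ - 2) ≤ (1 + ‖x‖ ^ 2) ^ (σ / 2 - 1) := by
    have h : (1 + ‖x‖) ^ (σ - 2) = ((1 + ‖x‖) ^ 2) ^ (σ / 2 - 1) := by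
      rw [← Real.rpow_natCast, ← Real.rpow_mul (by positivity)]
      congr 1
      push_cast
      ring
    rw [h]
    exact Real.rpow_le_rpow_of_nonpos (by positivity) (by nlinarith) (by linarith)
  have h2 : (1 + ‖x‖) ^ (σ - 1) = (1 + ‖x‖) ^ (σ - 2) * (1 + ‖x‖) := by
    rw [← Real.rpow_add_one (by positivity)]
    ring_nf
  calc 1 / 2 * (1 + ‖x‖) ^ (σ - 1) = 1 * (1 + ‖x‖) ^ (σ - 2) * ((1 + ‖x‖) / 2) := by
        rw [h2]; ring
    _ ≤ σ * (1 + ‖x‖ ^ 2) ^ (σ / 2 - 1) * ‖x‖ := by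
        gcongr
        linarith

/-! ### Excluding exact growth of order γ in [1, 2s) -/

/-- Subsolutions of the coercive equation cannot grow exactly like `|x| ^ γ` for `1 ≤ γ < 2 s`. -/
theorem limsup_nonpos_of_subsolution {n : ℕ} (hn : 0 < n) {s lam Lam m M γ : ℝ}
    (hs : 1 / 2 ≤ s) (hs1 : s < 1) (hlam : 0 < lam) (hLam : lam ≤ Lam) (hm : 1 < m)
    (hγ1 : 1 ≤ γ) (hγ : γ < 2 * s)
    {I : (EuclideanSpace ℝ (Fin n) → ℝ) → EuclideanSpace ℝ (Fin n) → ℝ}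
    (hI : IsEllipticOperator s (symKernelClass n s lam Lam) I)
    {u : EuclideanSpace ℝ (Fin n) → ℝ} (huc : Continuous u) (hu0 : ∀ x, 0 ≤ u x)
    (hu : IsViscositySubsolution s I (fun _ p => ‖p‖ ^ m) u)
    (hM : ∀ x, u x ≤ M * (1 + ‖x‖) ^ γ) :
    limsup (fun x : EuclideanSpace ℝ (Fin n) => ((|u x| / ‖x‖ ^ γ : ℝ) : EReal))
      (Bornology.cobounded (EuclideanSpace ℝ (Fin n))) ≤ 0 := by
  by_contra! hlim
  obtain ⟨δ, hδ0, hδ⟩ := EReal.lt_iff_exists_real_btwn.1 hlim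
  have hδ0 : 0 < δ := by exact_mod_cast hδ0
  have hfreq := frequently_lt_of_lt_limsup (by isBoundedDefault) hδ
  obtain ⟨σ, hγσ, hσs⟩ := exists_between hγ
  set C : ℝ := Lam * ∫ z : EuclideanSpace ℝ (Fin n),
    splitPow σ ‖z‖ * ‖z‖ ^ (-((n : ℝ) + 2 * s))
  have hM0 : 0 ≤ M := by
    have := (hu0 0).trans (hM 0)
    simpa using this
  -- Chosen so that (M+1)(cR)^γ = (δ/2)R^γ, whence u(y) ≥ (δ/2)R^γ forces 1 + |y| ≥ cR. Using M + 1
  -- avoids dividing by zero.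
  set c : ℝ := (δ / (2 * (M + 1))) ^ (1 / γ) with hc
  have hc0 : 0 < c := by positivity
  set κ : ℝ := (δ / 4) ^ (m - 1) * (1 / 2 * c ^ (σ - 1)) ^ m with hκ
  have hκ0 : 0 < κ := by positivity
  have he : 0 < (γ - 1) * (m - 1) + (σ - 1) :=
    add_pos_of_nonneg_of_pos (mul_nonneg (by linarith) (by linarith)) (by linarith)
  have hnorm := tendsto_norm_cobounded_atTop (E := EuclideanSpace ℝ (Fin n))
  have hev1 := ((tendsto_rpow_atTop he).comp hnorm).eventually_gt_atTop (C / κ)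
  -- R ≥ 2/c gives cR ≥ 2, hence |y| ≥ 1, where the lower bound on |∇ψ| applies.
  have hev2 := hnorm.eventually_ge_atTop (max 1 (2 / c))
  obtain ⟨x, hx, hx1, hx2⟩ := (hfreq.and_eventually (hev1.and hev2)).exists
  set R := ‖x‖ with hR
  have hR1 : 1 ≤ R := (le_max_left _ _).trans hx2
  have hR0 : 0 < R := by linarith
  have hRc : 2 ≤ c * R := by
    have := (le_max_right _ _).trans hx2
    rwa [div_le_iff₀' hc0] at this
  have hux : δ * R ^ γ ≤ u x := by
    have h1 : δ < |u x| / R ^ γ := by exact_mod_cast hx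
    rw [abs_of_nonneg (hu0 x), lt_div_iff₀ (by positivity)] at h1
    exact h1.le
  -- As ψ(x) ≤ 2R^σ, this makes the penalty at x at most half of δR^γ, so the maximum of u - εψ is
  -- at least (δ/2)R^γ.
  set ε : ℝ := δ / 4 * R ^ (γ - σ) with hε
  have hε0 : 0 < ε := by positivity
  have hψx : ε * bracketPow σ x ≤ δ / 2 * R ^ γ := by
    have h1 : bracketPow σ x ≤ 2 * R ^ σ := by
      have h : R ^ σ = (R ^ 2) ^ (σ / 2) := by
        rw [← Real.rpow_natCast, ← Real.rpow_mul (by positivity)]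
        congr 1
        push_cast
        ring
      calc bracketPow σ x ≤ (2 * R ^ 2) ^ (σ / 2) :=
            Real.rpow_le_rpow (by positivity) (by nlinarith) (by linarith)
        _ = 2 ^ (σ / 2) * R ^ σ := by rw [Real.mul_rpow (by positivity) (by positivity), h]
        _ ≤ 2 ^ (1 : ℝ) * R ^ σ := by
            gcongr
            · norm_num
            · linarith
        _ = _ := by rw [Real.rpow_one]
    calc ε * bracketPow σ x ≤ δ / 4 * R ^ (γ - σ) * (2 * R ^ σ) := by gcongr
      _ = δ / 2 * (R ^ (γ - σ) * R ^ σ) := by ring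
      _ = _ := by rw [← Real.rpow_add hR0]; ring_nf
  have hpos : 0 < R ^ γ := by positivity
  obtain ⟨y, hy⟩ := Continuous.exists_forall_ge' (f := fun y => u y - ε * bracketPow σ y)
    (huc.sub (continuous_const.mul continuous_bracketPow)) x (by
      filter_upwards [eventually_le_mul_bracketPow (by linarith) (by linarith) hγσ hε0 hM]
        with y hy
      nlinarith)
  have huy : δ / 2 * R ^ γ ≤ u y := by
    have h1 := hy x
    have h2 := mul_pos hε0 (bracketPow_pos (σ := σ) y)
    linarith
  have hyR : c * R ≤ 1 + ‖y‖ := by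
    have h1 : δ / 2 * R ^ γ ≤ (M + 1) * (1 + ‖y‖) ^ γ :=
      (huy.trans (hM y)).trans (mul_le_mul_of_nonneg_right (by linarith) (by positivity))
    have h2 : (c * R) ^ γ ≤ (1 + ‖y‖) ^ γ := by
      rw [Real.mul_rpow hc0.le hR0.le, hc, ← Real.rpow_mul (by positivity),
        one_div_mul_cancel (by linarith), Real.rpow_one, div_mul_eq_mul_div,
        div_le_iff₀ (by positivity)]
      linarith
    exact (Real.rpow_le_rpow_iff (by positivity) (by positivity) (by linarith)).1 h2
  have hvisc := hu.le_of_isMax_sub_bracketPow hn hs hs1 hlam (σ := σ) (C := C) (by linarith) hσs hε0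
    (fun K hK => hK.1) (symKernelClass_nonempty hLam) hI
    (fun K hK => linOp_bracketPow_le_of_symm hn hs hs1 hlam (by linarith) hσs hK y) hy
  simp only [norm_smul, Real.norm_of_nonneg hε0.le] at hvisc
  have hgr : 1 / 2 * (c * R) ^ (σ - 1) ≤ ‖gradient (bracketPow σ) y‖ :=
    le_trans (by gcongr; linarith) (le_norm_gradient_bracketPow (by linarith) (by linarith)
      (by linarith))
  have h3 : (ε * (1 / 2 * (c * R) ^ (σ - 1))) ^ m ≤ ε * C :=
    le_trans (Real.rpow_le_rpow (by positivity) (by gcongr) (by linarith)) hvisc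
  -- One factor ε is split off to cancel against εC; the remaining ε^(m-1) contributes
  -- R^((γ-σ)(m-1)).
  have h4 : (ε * (1 / 2 * (c * R) ^ (σ - 1))) ^ m =
      ε * (κ * R ^ ((γ - 1) * (m - 1) + (σ - 1))) := by
    have h5 : ε ^ m = ε * ε ^ (m - 1) := by
      rw [← Real.rpow_one_add' hε0.le (by linarith)]; ring_nf
    rw [Real.mul_rpow hε0.le (by positivity), h5, hκ, Real.mul_rpow hc0.le hR0.le,
      ← mul_assoc (1 / 2),
      Real.mul_rpow (x := 1 / 2 * c ^ (σ - 1)) (by positivity) (by positivity),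
      ← Real.rpow_mul hR0.le (σ - 1) m]
    nth_rewrite 2 [hε]
    rw [Real.mul_rpow (by positivity) (by positivity), ← Real.rpow_mul hR0.le]
    have h6 : (γ - 1) * (m - 1) + (σ - 1) = (γ - σ) * (m - 1) + (σ - 1) * m := by ring
    rw [h6, Real.rpow_add hR0]
    ring
  rw [h4] at h3
  have h7 := le_of_mul_le_mul_left h3 hε0
  simp only [Function.comp_apply] at hx1
  rw [div_lt_iff₀' hκ0] at hx1
  linarith

/-! ### Doubling of variables -/

lemma hasGradientAt_norm_sub {n : ℕ} {x y : EuclideanSpace ℝ (Fin n)} (hxy : x ≠ y) :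
    HasGradientAt (fun z => ‖z - y‖) (‖x - y‖⁻¹ • (x - y)) x := by
  have hne : ‖x - y‖ ^ 2 ≠ 0 := by
    have := norm_pos_iff.2 (sub_ne_zero.2 hxy)
    positivity
  have h1 := (((hasFDerivAt_id x).sub_const y).norm_sq).sqrt hne
  simp only [id, Real.sqrt_sq (norm_nonneg _)] at h1
  rw [hasGradientAt_iff_hasFDerivAt]
  refine h1.congr_fderiv ?_
  ext z
  simp
  ring

/-- A consequence of the parallelogram identity. It controls the two patched cones near the maximum
point, where one is displaced by z and the other, seen from the opposite end, by -z. -/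
lemma norm_add_add_norm_sub_le {E : Type*} [NormedAddCommGroup E] [InnerProductSpace ℝ E]
    {d : E} (hd : d ≠ 0) (z : E) :
    ‖d + z‖ + ‖d - z‖ - 2 * ‖d‖ ≤ ‖z‖ ^ 2 / ‖d‖ := by
  have hd0 : 0 < ‖d‖ := norm_pos_iff.2 hd
  have h1 : ‖d + z‖ ^ 2 + ‖d - z‖ ^ 2 = 2 * (‖d‖ ^ 2 + ‖z‖ ^ 2) := by
    rw [norm_add_sq_real, norm_sub_sq_real]; ring
  have h2 : ‖z‖ ^ 2 = ‖z‖ ^ 2 / ‖d‖ * ‖d‖ := by field_simp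
  have h3 : 0 ≤ ‖z‖ ^ 2 / ‖d‖ := by positivity
  set t := ‖z‖ ^ 2 / ‖d‖
  have h4 : ‖d + z‖ + ‖d - z‖ ≤ 2 * ‖d‖ + t := by
    refine abs_le_of_sq_le_sq' ?_ (by positivity) |>.2
    nlinarith [sq_nonneg (‖d + z‖ - ‖d - z‖), sq_nonneg t]
  linarith

lemma tendsto_integral_indicator_sq_mul {n : ℕ} (hn : 0 < n) {s : ℝ} (hs : 0 < s) (hs1 : s < 1) :
    Tendsto (fun r : ℝ => ∫ z : EuclideanSpace ℝ (Fin n),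
      (if ‖z‖ < r then ‖z‖ ^ 2 else 0) * ‖z‖ ^ (-((n : ℝ) + 2 * s))) (𝓝[>] 0) (𝓝 0) := by
  have h := tendsto_integral_filter_of_dominated_convergence (l := 𝓝[>] (0 : ℝ))
    (μ := (volume : Measure (EuclideanSpace ℝ (Fin n))))
    (F := fun r z => (if ‖z‖ < r then ‖z‖ ^ 2 else 0) * ‖z‖ ^ (-((n : ℝ) + 2 * s)))
    (f := fun _ => 0) (fun z => splitPow 0 ‖z‖ * ‖z‖ ^ (-((n : ℝ) + 2 * s)))
    (Eventually.of_forall fun r => ?_) ?_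
    (integrable_splitPow_mul hn hs1 (by linarith)) (Eventually.of_forall fun z => ?_)
  · simpa using h
  · refine Measurable.aestronglyMeasurable (Measurable.mul ?_ (by fun_prop))
    exact Measurable.ite (measurableSet_lt measurable_norm measurable_const) (by fun_prop)
      (by fun_prop)
  · filter_upwards [Ioo_mem_nhdsGT (zero_lt_one (α := ℝ))] with r hr
    refine Eventually.of_forall fun z => ?_
    have h0 : 0 ≤ ‖z‖ ^ (-((n : ℝ) + 2 * s)) := by positivity
    rw [norm_mul, Real.norm_of_nonneg h0]
    refine mul_le_mul_of_nonneg_right ?_ h0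
    split_ifs with hz
    · rw [splitPow, if_pos (hz.trans hr.2), Real.norm_of_nonneg (by positivity)]
    · simpa using splitPow_nonneg 0 (norm_nonneg z)
  · refine tendsto_const_nhds.congr' ?_
    rcases eq_or_ne z 0 with rfl | hz
    · simp
    · filter_upwards [Ioo_mem_nhdsGT (norm_pos_iff.2 hz)] with r hr
      rw [if_neg (not_lt.2 hr.2.le), zero_mul]

/-- The function which is maximised in the doubling of variables. -/
noncomputable def doubled {n : ℕ} (u : EuclideanSpace ℝ (Fin n) → ℝ) (μ A ε σ : ℝ)
    (x y : EuclideanSpace ℝ (Fin n)) : ℝ :=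
  u x - μ * u y - A * ‖x - y‖ - ε * bracketPow σ x

/-- Where the doubled function is positive, x lies in the compact set on which εψ fails to dominate
u, and A|x-y| ≤ u(x) confines y. A positive value is therefore beaten only inside a compact set. -/
lemma exists_isMax_doubled {n : ℕ} {u : EuclideanSpace ℝ (Fin n) → ℝ} {M γ μ A ε σ : ℝ}
    (huc : Continuous u) (hu0 : ∀ x, 0 ≤ u x) (hM : ∀ x, u x ≤ M * (1 + ‖x‖) ^ γ)
    (hσ : 0 ≤ σ) (hσ2 : σ ≤ 2) (hγ : γ < σ) (hμ : 0 < μ) (hA : 0 < A) (hε : 0 < ε)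
    {x₀ y₀ : EuclideanSpace ℝ (Fin n)} (hpos : 0 < doubled u μ A ε σ x₀ y₀) :
    ∃ x y, ∀ x' y', doubled u μ A ε σ x' y' ≤ doubled u μ A ε σ x y := by
  obtain ⟨T, hT, hTu⟩ := mem_cocompact.1 (eventually_le_mul_bracketPow hσ hσ2 hγ hε hM)
  obtain ⟨B, hB⟩ := (hT.image huc).bddAbove
  obtain ⟨ρ, hρ⟩ := hT.isBounded.exists_norm_le
  have hcont : Continuous fun p : EuclideanSpace ℝ (Fin n) × EuclideanSpace ℝ (Fin n) =>
      doubled u μ A ε σ p.1 p.2 := by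
    have := continuous_bracketPow (n := n) (σ := σ)
    unfold doubled
    fun_prop
  obtain ⟨p, hp⟩ := hcont.exists_forall_ge' (x₀, y₀) (by
    refine mem_cocompact.2 ⟨T ×ˢ Metric.closedBall 0 (ρ + B / A),
      hT.prod (isCompact_closedBall _ _), fun p hp => ?_⟩
    by_contra hlt
    refine hp ?_
    have hp0 : 0 < doubled u μ A ε σ p.1 p.2 := hpos.trans (not_le.1 hlt)
    unfold doubled at hp0
    have h1 := mul_nonneg hμ.le (hu0 p.2)
    have h2 := mul_nonneg hA.le (norm_nonneg (p.1 - p.2))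
    have h3 := mul_pos hε (bracketPow_pos (σ := σ) p.1)
    have hpT : p.1 ∈ T := by
      by_contra hpT
      have : u p.1 ≤ ε * bracketPow σ p.1 := hTu hpT
      linarith
    refine ⟨hpT, ?_⟩
    have h4 : u p.1 ≤ B := hB ⟨p.1, hpT, rfl⟩
    have h5 : ‖p.1 - p.2‖ ≤ B / A := by
      rw [le_div_iff₀' hA]; linarith
    have h6 := norm_sub_le p.1 (p.1 - p.2)
    rw [sub_sub_cancel] at h6
    rw [mem_closedBall_zero_iff]
    exact h6.trans (add_le_add (hρ _ hpT) h5))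
  exact ⟨p.1, p.2, fun x' y' => hp (x', y')⟩

lemma IsViscositySolution.le_of_isMax_doubled {n : ℕ} (hn : 0 < n) {s lam Lam σ ε C μ A : ℝ}
    (hs : 1 / 2 ≤ s) (hs1 : s < 1) (hlam : 0 < lam) (hσ : 0 ≤ σ) (hσs : σ < 2 * s)
    (hε : 0 < ε) (hμ : 0 < μ) (hA : 0 < A)
    {𝒦 : Set (EuclideanSpace ℝ (Fin n) → ℝ)} (h𝒦 : 𝒦 ⊆ kernelClass n s lam Lam)
    (h𝒦0 : 𝒦.Nonempty)
    {I : (EuclideanSpace ℝ (Fin n) → ℝ) → EuclideanSpace ℝ (Fin n) → ℝ}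
    (hI : IsEllipticOperator s 𝒦 I) {H : ℝ → EuclideanSpace ℝ (Fin n) → ℝ}
    {u : EuclideanSpace ℝ (Fin n) → ℝ} (hu : IsViscositySolution s I H u)
    {x y : EuclideanSpace ℝ (Fin n)} (hxy : x ≠ y)
    (hC : ∀ K ∈ 𝒦, linOp s K (bracketPow σ) x ≤ C)
    (hmax : ∀ x' y', doubled u μ A ε σ x' y' ≤ doubled u μ A ε σ x y) :
    H (u x) ((A * ‖x - y‖⁻¹) • (x - y) + ε • gradient (bracketPow σ) x) -
      μ * H (u y) (μ⁻¹ • (A * ‖x - y‖⁻¹) • (x - y)) ≤ ε * C := by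
  set p := (A * ‖x - y‖⁻¹) • (x - y) with hp
  have hd0 : 0 < ‖x - y‖ := norm_pos_iff.2 (sub_ne_zero.2 hxy)
  set φ₁ : EuclideanSpace ℝ (Fin n) → ℝ :=
    fun z => u x + (A * (‖z - y‖ - ‖x - y‖) + ε * (bracketPow σ z - bracketPow σ x)) with hφ₁
  set φ₂ : EuclideanSpace ℝ (Fin n) → ℝ :=
    fun z => u y - μ⁻¹ * A * (‖z - x‖ - ‖x - y‖) with hφ₂
  have hcψ := continuous_bracketPow (n := n) (σ := σ)
  have hφ₁c : Continuous φ₁ := by fun_prop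
  have hφ₂c : Continuous φ₂ := by fun_prop
  have hφ₁d : ∀ z, z ≠ y → ContDiffAt ℝ 2 φ₁ z := fun z hz =>
    contDiffAt_const.add ((contDiffAt_const.mul (((contDiffAt_id.sub contDiffAt_const).norm ℝ
      (sub_ne_zero.2 hz)).sub contDiffAt_const)).add
      (contDiffAt_const.mul (contDiff_bracketPow.contDiffAt.sub contDiffAt_const)))
  have hφ₂d : ∀ z, z ≠ x → ContDiffAt ℝ 2 φ₂ z := fun z hz =>
    contDiffAt_const.sub (contDiffAt_const.mul (((contDiffAt_id.sub contDiffAt_const).norm ℝ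
      (sub_ne_zero.2 hz)).sub contDiffAt_const))
  have hg₁ : gradient φ₁ x = p + ε • gradient (bracketPow σ) x := by
    refine HasGradientAt.gradient ?_
    rw [hasGradientAt_iff_hasFDerivAt, gradient_bracketPow]
    refine HasFDerivAt.congr_fderiv
      (((((hasGradientAt_norm_sub hxy).hasFDerivAt.sub_const _).const_mul A).add
      (((hasGradientAt_bracketPow x).hasFDerivAt.sub_const _).const_mul ε)).const_add _) ?_
    rw [hp, mul_smul A, ← map_smul, ← map_smul, ← map_add]
  have hg₂ : HasGradientAt φ₂ (μ⁻¹ • p) y := by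
    have h1 := ((((hasGradientAt_norm_sub hxy.symm).hasFDerivAt.sub_const ‖x - y‖).const_mul
      (μ⁻¹ * A)).const_sub (u y))
    rw [hasGradientAt_iff_hasFDerivAt]
    refine h1.congr_fderiv ?_
    rw [← map_smul, ← map_neg]
    congr 1
    rw [hp, norm_sub_rev y x, ← smul_neg, ← smul_neg, neg_sub, smul_smul, smul_smul, mul_assoc]
  have hle₁ : ∀ z, u z ≤ φ₁ z := fun z => by
    have := hmax z y
    simp only [doubled] at this
    simp only [hφ₁]
    linarith
  have hle₂ : ∀ z, φ₂ z ≤ u z := fun z => by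
    have := hmax x z
    simp only [doubled] at this
    simp only [hφ₂]
    rw [norm_sub_rev z x, mul_assoc, sub_le_iff_le_add, ← sub_le_iff_le_add', inv_mul_eq_div,
      le_div_iff₀ hμ]
    linarith
  -- With r < |x-y| the test balls avoid the vertices of the cones. Patching costs an error carried
  -- by |z| < r, which vanishes as r → 0.
  have hbound : ∀ r ∈ Set.Ioo 0 ‖x - y‖,
      H (u x) (p + ε • gradient (bracketPow σ) x) - μ * H (u y) (μ⁻¹ • p) ≤
      ε * C + A / ‖x - y‖ * (Lam * ∫ z : EuclideanSpace ℝ (Fin n),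
        (if ‖z‖ < r then ‖z‖ ^ 2 else 0) * ‖z‖ ^ (-((n : ℝ) + 2 * s))) := by
    rintro r ⟨hr, hrd⟩
    set v := testPatch u φ₁ x r with hv
    set w := testPatch u φ₂ y r with hw
    have hva : Admissible s v x :=
      admissible_testPatch hr hu.1.memWeightedL1 hφ₁c (hφ₁d x hxy)
    have hwa : Admissible s w y :=
      admissible_testPatch hr hu.1.memWeightedL1 hφ₂c (hφ₂d y hxy.symm)
    -- Comparing v with μw rather than w makes the gradients at x and y agree up to ε∇ψ(x), so the
    -- first order terms involving p cancel.
    have hwa' : Admissible s (fun z => μ * w z) y := ⟨hwa.1.const_mul μ, hwa.2.const_mul μ⟩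
    have ht₁ := hu.1.test x r φ₁ hr (fun z hz => (hφ₁d z (by
      rintro rfl
      rw [Metric.mem_ball, dist_comm, dist_eq_norm] at hz
      linarith)).contDiffWithinAt) (by simp [hφ₁]) (fun z _ => hle₁ z) hva.2
    have ht₂ := hu.2.test y r φ₂ hr (fun z hz => (hφ₂d z (by
      rintro rfl
      rw [Metric.mem_ball, dist_eq_norm] at hz
      linarith)).contDiffWithinAt) (by simp [hφ₂, norm_sub_rev y x]) (fun z _ => hle₂ z) hwa.2
    rw [hg₁] at ht₁
    rw [hg₂.gradient] at ht₂
    have hIw := hI.pos_homogeneous w y μ hμ hwa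
    have hv0 : v x = u x := by simp [hv, testPatch, hφ₁]
    have hw0 : w y = u y := by simp [hw, testPatch, hφ₂, norm_sub_rev y x]
    have hvg : gradient v x = p + ε • gradient (bracketPow σ) x := by
      rw [hv, gradient_testPatch u φ₁ x hr, hg₁]
    have hwg : gradient (fun z => μ * w z) y = p := by
      have h1 : HasGradientAt w (μ⁻¹ • p) y :=
        hg₂.congr_of_eventuallyEq (testPatch_eventuallyEq u φ₂ y hr).symm
      refine HasGradientAt.gradient ?_
      rw [hasGradientAt_iff_hasFDerivAt]
      refine (h1.hasFDerivAt.const_mul μ).congr_fderiv ?_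
      rw [← map_smul, smul_inv_smul₀ hμ.ne']
    have key : I v x - I (fun z => μ * w z) y ≤
        ε * C + A / ‖x - y‖ * (Lam * ∫ z : EuclideanSpace ℝ (Fin n),
        (if ‖z‖ < r then ‖z‖ ^ 2 else 0) * ‖z‖ ^ (-((n : ℝ) + 2 * s))) := by
      refine hI.sub_le (by linarith) h𝒦0 hva hwa' fun K hK => ?_
      have hint := (integrable_linIntegrand_mul hn hs hs1 hlam (h𝒦 hK)
        (admissible_bracketPow (n := n) hσ hσs x)).const_mul ε
      have hgm : Measurable (fun z : EuclideanSpace ℝ (Fin n) =>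
          if ‖z‖ < r then ‖z‖ ^ 2 else 0) :=
        Measurable.ite (measurableSet_lt measurable_norm measurable_const) (by fun_prop)
          (by fun_prop)
      have hg0 : ∀ z : EuclideanSpace ℝ (Fin n), 0 ≤ if ‖z‖ < r then ‖z‖ ^ 2 else 0 := fun z => by
        split_ifs <;> positivity
      have hgi : Integrable (fun z : EuclideanSpace ℝ (Fin n) =>
          (if ‖z‖ < r then ‖z‖ ^ 2 else 0) * ‖z‖ ^ (-((n : ℝ) + 2 * s))) := by
        have hb := ((integrable_splitPow_mul hn hs1 (σ := 0) (s := s) (by linarith)).const_mul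
          (1 + r ^ 2))
        refine hb.mono' (hgm.mul (by fun_prop)).aestronglyMeasurable
          (Eventually.of_forall fun z => ?_)
        have h0 : 0 ≤ ‖z‖ ^ (-((n : ℝ) + 2 * s)) := by positivity
        rw [norm_mul, Real.norm_of_nonneg h0, Real.norm_of_nonneg (hg0 z), ← mul_assoc]
        refine mul_le_mul_of_nonneg_right ?_ h0
        have hz0 := norm_nonneg z
        unfold splitPow
        split_ifs with h1 h2 h2
        · nlinarith [sq_nonneg (r * ‖z‖)]
        · rw [Real.rpow_zero]
          nlinarith
        · positivity
        · positivity
      have hgK := integrable_mul_kernel_of_le hn hlam (h𝒦 hK) hgm.aestronglyMeasurable hgi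
        fun z => (abs_of_nonneg (hg0 z)).le
      have hgle := integral_mul_kernel_le hn hlam (h𝒦 hK) hg0 hgm.aestronglyMeasurable hgi
      have hsum := hint.add (hgK.const_mul (A / ‖x - y‖))
      refine (linOp_sub_le hn hs hs1 hlam (h𝒦 hK) hva hwa'
        (f := fun z => ε * linIntegrand (bracketPow σ) x z +
          A / ‖x - y‖ * (if ‖z‖ < r then ‖z‖ ^ 2 else 0)) ?_ fun z => ?_).trans ?_
      · refine hsum.congr (Eventually.of_forall fun z => ?_)
        simp only [Pi.add_apply]
        ring
      -- Both points move by the same z, which leaves x - y unchanged. Outside the ball this is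
      -- maximality at (x+z, y+z); inside, the patches are explicit and the cone estimate applies.
      · have hz : v (x + z) - u x - (μ * w (y + z) - μ * u y) ≤
            ε * (bracketPow σ (x + z) - bracketPow σ x) +
            A / ‖x - y‖ * (if ‖z‖ < r then ‖z‖ ^ 2 else 0) := by
          by_cases hzr : ‖z‖ < r
          · have e1 : v (x + z) = φ₁ (x + z) := by simp [hv, testPatch, hzr]
            have e2 : w (y + z) = φ₂ (y + z) := by simp [hw, testPatch, hzr]
            have e3 : x + z - y = (x - y) + z := by abel
            have e4 : ‖y + z - x‖ = ‖(x - y) - z‖ := by rw [← norm_neg]; congr 1; abel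
            have h1 := mul_le_mul_of_nonneg_left
              (norm_add_add_norm_sub_le (sub_ne_zero.2 hxy) z) hA.le
            have h2 : A / ‖x - y‖ * ‖z‖ ^ 2 = A * (‖z‖ ^ 2 / ‖x - y‖) := by ring
            have h3 : μ * (μ⁻¹ * A * (‖x - y - z‖ - ‖x - y‖)) = A * (‖x - y - z‖ - ‖x - y‖) := by
              field_simp
            rw [if_pos hzr, e1, e2, h2]
            simp only [hφ₁, hφ₂, e3, e4, mul_sub μ, h3]
            linarith
          · have e1 : v (x + z) = u (x + z) := by simp [hv, testPatch, hzr]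
            have e2 : w (y + z) = u (y + z) := by simp [hw, testPatch, hzr]
            have h1 := hmax (x + z) (y + z)
            simp only [doubled, add_sub_add_right_eq_sub] at h1
            rw [if_neg hzr, e1, e2]
            linarith
        simp only [linIntegrand, hvg, hwg, hv0, hw0, inner_add_left, real_inner_smul_left]
        split_ifs at hz ⊢ <;> linarith
      · have heq : ∫ z, (ε * linIntegrand (bracketPow σ) x z +
            A / ‖x - y‖ * (if ‖z‖ < r then ‖z‖ ^ 2 else 0)) * K z =
            ε * linOp s K (bracketPow σ) x +
            A / ‖x - y‖ * ∫ z, (if ‖z‖ < r then ‖z‖ ^ 2 else 0) * K z := by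
          rw [linOp_eq_integral hs hs1, ← integral_const_mul, ← integral_const_mul,
            ← integral_add hint (hgK.const_mul _)]
          simp only [add_mul, mul_assoc]
        rw [heq]
        have hCK := hC K hK
        gcongr
    have hmul := mul_nonneg hμ.le ht₂
    rw [hIw] at key
    linarith
  have hlim := ((((tendsto_integral_indicator_sq_mul hn (s := s) (by linarith) hs1).const_mul
    Lam).const_mul (A / ‖x - y‖)).const_add (ε * C))
  simp only [mul_zero, add_zero] at hlim
  exact ge_of_tendsto hlim (Filter.mem_of_superset (Ioo_mem_nhdsGT hd0) hbound)

theorem IsViscositySolution.le_mul_add {n : ℕ} (hn : 0 < n) {s lam Lam M γ q m μ A : ℝ}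
    (hs : 1 / 2 ≤ s) (hs1 : s < 1) (hlam : 0 < lam) (hμ : 1 < μ) (hA : 0 < A)
    {𝒦 : Set (EuclideanSpace ℝ (Fin n) → ℝ)} (h𝒦 : 𝒦 ⊆ kernelClass n s lam Lam)
    (h𝒦0 : 𝒦.Nonempty)
    {I : (EuclideanSpace ℝ (Fin n) → ℝ) → EuclideanSpace ℝ (Fin n) → ℝ}
    (hI : IsEllipticOperator s 𝒦 I) (hq : 0 ≤ q) (hm : 0 ≤ m) (hqm : 1 < q + m)
    {u : EuclideanSpace ℝ (Fin n) → ℝ} (huc : Continuous u) (hu0 : ∀ x, 0 ≤ u x)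
    (hu : IsViscositySolution s I (fun r p => r ^ q * ‖p‖ ^ m) u) (hγ : γ < 1)
    (hM : ∀ x, u x ≤ M * (1 + ‖x‖) ^ γ) (x₀ y₀ : EuclideanSpace ℝ (Fin n)) :
    u x₀ ≤ μ * u y₀ + A * ‖x₀ - y₀‖ := by
  by_contra! hlt
  obtain ⟨σ, hσγ, hσ1⟩ := exists_between (max_lt hγ (zero_lt_one (α := ℝ)))
  have hγσ : γ < σ := (le_max_left _ _).trans_lt hσγ
  have hσ : 0 ≤ σ := ((le_max_right _ _).trans_lt hσγ).le
  set C : ℝ := Lam * ∫ z : EuclideanSpace ℝ (Fin n),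
    splitPow σ ‖z‖ * ‖z‖ ^ (-((n : ℝ) + 2 * s))
  have hμ0 : 0 < μ := by linarith
  -- Half the assumed excess: once εψ(x₀) < η the maximum exceeds η, so u(x) > η at the maximum
  -- point whatever ε is.
  set η := (u x₀ - μ * u y₀ - A * ‖x₀ - y₀‖) / 2 with hη
  have hη0 : 0 < η := by rw [hη]; linarith
  set c := μ ^ (1 - (q + m)) with hc
  have hc1 : c < 1 := Real.rpow_lt_one_of_one_lt_of_neg hμ (by linarith)
  have hAm : 0 < A ^ m := Real.rpow_pos_of_pos hA m
  have hlim1 : Tendsto (fun ε : ℝ => (A - ε) ^ m - c * A ^ m) (𝓝[>] 0)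
      (𝓝 (A ^ m - c * A ^ m)) := by
    have h1 : Tendsto (fun ε : ℝ => A - ε) (𝓝[>] 0) (𝓝 A) := by
      have : Tendsto (fun ε : ℝ => A - ε) (𝓝 0) (𝓝 (A - 0)) := by
        exact (continuous_const.sub continuous_id).tendsto 0
      rw [sub_zero] at this
      exact this.mono_left nhdsWithin_le_nhds
    exact (h1.rpow_const (Or.inl hA.ne')).sub_const _
  have hκ : 0 < A ^ m - c * A ^ m := by nlinarith
  have hlim2 : Tendsto (fun ε : ℝ => ε * C) (𝓝[>] 0) (𝓝 0) := by
    have : Tendsto (fun ε : ℝ => ε * C) (𝓝 0) (𝓝 (0 * C)) :=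
      (continuous_id.mul continuous_const).tendsto 0
    rw [zero_mul] at this
    exact this.mono_left nhdsWithin_le_nhds
  have hsmall : ∀ᶠ ε in 𝓝[>] (0 : ℝ), ε < min A (η / bracketPow σ x₀) ∧ 0 < ε := by
    filter_upwards [Ioo_mem_nhdsGT (lt_min hA (div_pos hη0 (bracketPow_pos (σ := σ) x₀)))]
      with ε h
    exact ⟨h.2, h.1⟩
  have hev : ∀ᶠ ε in 𝓝[>] (0 : ℝ), η ^ q * ((A - ε) ^ m - c * A ^ m) ≤ ε * C := by
    filter_upwards [hsmall, hlim1.eventually_const_lt hκ] with ε ⟨hε, hε0⟩ hεκ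
    have hεA : ε < A := hε.trans_le (min_le_left _ _)
    have hεψ : ε * bracketPow σ x₀ < η :=
      (lt_div_iff₀ (bracketPow_pos x₀)).1 (hε.trans_le (min_le_right _ _))
    have hD0 : η < doubled u μ A ε σ x₀ y₀ := by
      unfold doubled
      linarith
    obtain ⟨x, y, hmax⟩ := exists_isMax_doubled huc hu0 hM hσ (by linarith) hγσ hμ0 hA hε0
      (hη0.trans hD0)
    have hD := hD0.trans_le (hmax x₀ y₀)
    unfold doubled at hD
    have hψ := mul_pos hε0 (bracketPow_pos (σ := σ) x)
    have hAd := mul_nonneg hA.le (norm_nonneg (x - y))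
    have huy := mul_nonneg hμ0.le (hu0 y)
    -- On the diagonal the doubled function is at most (1-μ)u(x) ≤ 0.
    have hxy : x ≠ y := by
      rintro rfl
      nlinarith [hu0 x]
    have hd0 : 0 < ‖x - y‖ := norm_pos_iff.2 (sub_ne_zero.2 hxy)
    have hmain := hu.le_of_isMax_doubled hn hs hs1 hlam hσ (by linarith) hε0 hμ0 hA h𝒦 h𝒦0 hI hxy
      (fun K hK => linOp_bracketPow_le hn hs hs1 hlam hσ hσ1 (h𝒦 hK) x) hmax
    set p := (A * ‖x - y‖⁻¹) • (x - y) with hp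
    have hpA : ‖p‖ = A := by
      rw [hp, norm_smul, Real.norm_of_nonneg (by positivity), mul_assoc,
        inv_mul_cancel₀ hd0.ne', mul_one]
    have hpε : A - ε ≤ ‖p + ε • gradient (bracketPow σ) x‖ := by
      have h1 := norm_sub_le (p + ε • gradient (bracketPow σ) x) (ε • gradient (bracketPow σ) x)
      rw [add_sub_cancel_right, hpA, norm_smul, Real.norm_of_nonneg hε0.le] at h1
      have h2 := mul_le_mul_of_nonneg_left (norm_gradient_bracketPow_le_one hσ hσ1.le x) hε0.le
      linarith
    -- Homogeneity rewrites the Hamiltonian at y in terms of μu(y), which is at most u(x), at the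
    -- price of the factor c < 1.
    have h2 : μ * (u y ^ q * ‖μ⁻¹ • p‖ ^ m) = c * (μ * u y) ^ q * A ^ m := by
      rw [norm_smul, Real.norm_of_nonneg (by positivity), hpA, Real.mul_rpow (by positivity) hA.le,
        Real.mul_rpow hμ0.le (hu0 y), Real.inv_rpow hμ0.le, hc, Real.rpow_sub hμ0, Real.rpow_one,
        Real.rpow_add hμ0]
      have := Real.rpow_pos_of_pos hμ0 q
      have := Real.rpow_pos_of_pos hμ0 m
      field_simp
    have h3 : (μ * u y) ^ q ≤ u x ^ q := Real.rpow_le_rpow huy (by linarith) hq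
    have h4 : (A - ε) ^ m ≤ ‖p + ε • gradient (bracketPow σ) x‖ ^ m :=
      Real.rpow_le_rpow (by linarith) hpε hm
    have h5 : η ^ q ≤ u x ^ q := Real.rpow_le_rpow hη0.le (by linarith) hq
    have hux : 0 ≤ u x ^ q := Real.rpow_nonneg (hu0 x) q
    have hc0 : 0 ≤ c := by positivity
    calc η ^ q * ((A - ε) ^ m - c * A ^ m) ≤ u x ^ q * ((A - ε) ^ m - c * A ^ m) :=
          mul_le_mul_of_nonneg_right h5 hεκ.le
      _ = u x ^ q * (A - ε) ^ m - c * u x ^ q * A ^ m := by ring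
      _ ≤ u x ^ q * ‖p + ε • gradient (bracketPow σ) x‖ ^ m - c * (μ * u y) ^ q * A ^ m := by
          gcongr
      _ ≤ ε * C := by rw [← h2]; exact hmain
  have hfin := le_of_tendsto_of_tendsto (hlim1.const_mul (η ^ q)) hlim2 hev
  have := mul_pos (Real.rpow_pos_of_pos hη0 q) hκ
  linarith

theorem IsViscositySolution.eq_of_sublinear {n : ℕ} (hn : 0 < n) {s lam Lam M γ q m : ℝ}
    (hs : 1 / 2 ≤ s) (hs1 : s < 1) (hlam : 0 < lam)
    {𝒦 : Set (EuclideanSpace ℝ (Fin n) → ℝ)} (h𝒦 : 𝒦 ⊆ kernelClass n s lam Lam)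
    (h𝒦0 : 𝒦.Nonempty)
    {I : (EuclideanSpace ℝ (Fin n) → ℝ) → EuclideanSpace ℝ (Fin n) → ℝ}
    (hI : IsEllipticOperator s 𝒦 I) (hq : 0 ≤ q) (hm : 0 ≤ m) (hqm : 1 < q + m)
    {u : EuclideanSpace ℝ (Fin n) → ℝ} (huc : Continuous u) (hu0 : ∀ x, 0 ≤ u x)
    (hu : IsViscositySolution s I (fun r p => r ^ q * ‖p‖ ^ m) u) (hγ : γ < 1)
    (hM : ∀ x, u x ≤ M * (1 + ‖x‖) ^ γ) (x y : EuclideanSpace ℝ (Fin n)) : u x = u y := by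
  have key : ∀ x y, u x ≤ u y := fun x y => by
    have h1 : Tendsto (fun t : ℝ => (1 + t) * u y + t * ‖x - y‖) (𝓝[>] 0) (𝓝 (u y)) := by
      have : Tendsto (fun t : ℝ => (1 + t) * u y + t * ‖x - y‖) (𝓝 0)
          (𝓝 ((1 + 0) * u y + 0 * ‖x - y‖)) :=
        Continuous.tendsto (by fun_prop) 0
      simp only [add_zero, one_mul, zero_mul] at this
      exact this.mono_left nhdsWithin_le_nhds
    refine ge_of_tendsto h1 ?_
    filter_upwards [self_mem_nhdsWithin] with t ht
    have ht : 0 < t := ht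
    exact hu.le_mul_add hn hs hs1 hlam (by linarith) ht h𝒦 h𝒦0 hI hq hm hqm huc hu0 hγ hM x y
  exact le_antisymm (key x y) (key y x)

/-! ### Conclusion -/

theorem mainTheorem3 (n : ℕ) (s lam Lam : ℝ) (hs : 1 / 2 ≤ s) (hs1 : s < 1)
    (hlam : 0 < lam) (hLam : lam ≤ Lam) :
    (∀ I : (EuclideanSpace ℝ (Fin n) → ℝ) → EuclideanSpace ℝ (Fin n) → ℝ,
      IsEllipticOperator s (kernelClass n s lam Lam) I →
      ∀ q m : ℝ, 0 ≤ q → 0 ≤ m → 1 < q + m →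
      ∀ u : EuclideanSpace ℝ (Fin n) → ℝ, (∀ x, 0 ≤ u x) →
        IsViscositySolution s I (fun r p => r ^ q * ‖p‖ ^ m) u →
        ∀ M γ : ℝ, γ < 1 → (∀ x, |u x| ≤ M * (1 + ‖x‖) ^ γ) →
        ∃ c : ℝ, ∀ x, u x = c) ∧
    (∀ I : (EuclideanSpace ℝ (Fin n) → ℝ) → EuclideanSpace ℝ (Fin n) → ℝ,
      IsEllipticOperator s (symKernelClass n s lam Lam) I →
      ∀ m : ℝ, 1 < m →
      ∀ u : EuclideanSpace ℝ (Fin n) → ℝ, (∀ x, 0 ≤ u x) →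
        IsViscositySolution s I (fun _ p => ‖p‖ ^ m) u →
        ∀ M γ : ℝ, γ < 2 * s → (∀ x, |u x| ≤ M * (1 + ‖x‖) ^ γ) →
        0 < limsup (fun x : EuclideanSpace ℝ (Fin n) => ((|u x| / ‖x‖ ^ γ : ℝ) : EReal))
          (Bornology.cobounded (EuclideanSpace ℝ (Fin n))) →
        ∃ c : ℝ, ∀ x, u x = c) := by
  have hsub : symKernelClass n s lam Lam ⊆ kernelClass n s lam Lam := fun K hK => hK.1
  have hne := symKernelClass_nonempty (n := n) (s := s) hLam
  -- In dimension 0 the space is a single point; the estimates above need the origin to be a null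
  -- set.
  rcases Nat.eq_zero_or_pos n with rfl | hn
  · exact ⟨fun _ _ _ _ _ _ _ u _ _ _ _ _ _ => ⟨u 0, fun x => by rw [Subsingleton.elim x 0]⟩,
      fun _ _ _ _ u _ _ _ _ _ _ _ => ⟨u 0, fun x => by rw [Subsingleton.elim x 0]⟩⟩
  refine ⟨fun I hI q m hq hm hqm u hu0 hu M γ hγ hM => ⟨u 0, fun x => ?_⟩,
    fun I hI m hm u hu0 hu M γ hγ hM hlim => ⟨u 0, fun x => ?_⟩⟩
  · have huc := continuous_iff_lower_upperSemicontinuous.2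
      ⟨hu.2.lowerSemicontinuous, hu.1.upperSemicontinuous⟩
    exact hu.eq_of_sublinear hn hs hs1 hlam subset_rfl (hne.mono hsub) hI hq hm hqm huc hu0 hγ
      (fun x => (le_abs_self _).trans (hM x)) x 0
  · have huc := continuous_iff_lower_upperSemicontinuous.2
      ⟨hu.2.lowerSemicontinuous, hu.1.upperSemicontinuous⟩
    have hM' := fun x => (le_abs_self _).trans (hM x)
    rcases lt_or_ge γ 1 with hγ1 | hγ1
    -- The case q = 0 of the first part, with r^0 = 1 even at r = 0.
    · refine IsViscositySolution.eq_of_sublinear hn hs hs1 hlam hsub hne hI le_rfl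
        (m := m) (by linarith) (by linarith) huc hu0 ?_ hγ1 hM' x 0
      simpa only [Real.rpow_zero, one_mul] using hu
    · exact absurd hlim (not_lt.2 (limsup_nonpos_of_subsolution hn hs hs1 hlam hLam hm hγ1 hγ hI
        huc hu0 hu.1 hM'))
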